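/- Let $\theta\in(0,\tfrac12]$ and let $\mathcal S_1$ be the Schreier family, i.e. the family consisting of $\emptyset$ and of all unions $\bigcup_{i=1}^{d} S_i$ of $d\ge 1$ singletons $S_1<\dots<S_d$ of $\mathbb N=\{1,2,\dots\}$ with $d\le \min S_1$. (For nonempty finite $E,F\subset\mathbb N$, $E<F$ means $\max E<\min F$.) On the space $c_{00}$ of finitely supported real sequences, with unit vectors $(e_i)_{i=1}^\infty$, let $\|\cdot\|_0$ be the supremum norm and, for $n\ge 0$, \[ \|x\|_{n+1}=\max\Big\{\|x\|_n,\ \sup\Big\{\theta\sum_{i=1}^d\|E_ix\|_n : d\ge 1,\ E_1<\dots<E_d \text{ nonempty finite subsets of }\mathbb N,\ \{\min E_i\}_{i=1}^d\in\mathcal S_1\Big\}\Big\}, \] where $Ex$ is the restriction of $x$ to the coordinates in $E$. Let $\|x\|=\sup_n\|x\|_n$ and let $T[\theta,\mathcal S_1]$ be the completion of $(c_{00},\|\cdot\|)$. Let $U\colon T[\theta,\mathcal S_1]\to T[\theta,\mathcal S_1]$ be a linear map. Then $U$ is an isometry (not assumed surjective) if and only if $U$ is continuous and there are a $\{-1,1\}$-valued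 sequence $(\varepsilon_i)_{i=1}^\infty$ and a permutation $\pi$ of $\{1,2,\dots,\lfloor\theta^{-1}\rfloor\}$ such that \[ Ue_i=\begin{cases}\varepsilon_i e_{\pi(i)}, & 1\le i\le\lfloor\theta^{-1}\rfloor,\\ \varepsilon_i e_i, & i>\lfloor\theta^{-1}\rfloor.\end{cases} \] -/

import Mathlib

noncomputable section

namespace Tsirelson

/-- `E < F` for finite sets of positive integers: every element of `E` is smaller than every
element of `F` (for nonempty sets, `max E < min F`). -/
def SetLT (E F : Finset ℕ+) : Prop := ∀ i ∈ E, ∀ j ∈ F, i < j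

/-- `E 0 < E 1 < ⋯ < E (d - 1)` are nonempty finite sets of positive integers. -/
structure IsConsecutive {d : ℕ} (E : Fin d → Finset ℕ+) : Prop where
  nonempty : ∀ i, (E i).Nonempty
  lt : ∀ i j, i < j → SetLT (E i) (E j)

/-- The family `𝒜ₙ` of sets with at most `n` elements. -/
def atMost (n : ℕ) : Set (Finset ℕ+) := {F | F.card ≤ n}

/-- The successor step of the Schreier hierarchy: `∅` together with all unions of `d` consecutive
nonempty members of `S` that satisfy `d ≤ S₁ < S₂ < ⋯ < S_d`. -/
def schreierSucc (S : Set (Finset ℕ+)) : Set (Finset ℕ+) :=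
  {F | ∃ (d : ℕ) (G : Fin d → Finset ℕ+), 0 < d ∧ IsConsecutive G ∧ (∀ i, G i ∈ S) ∧
      (∀ i, ∀ n ∈ G i, d ≤ (n : ℕ)) ∧ F = Finset.univ.biUnion G} ∪ {∅}

/-- The Schreier family `𝒮₁`, the successor of `𝒮₀ = 𝒜₁`. -/
def schreierOne : Set (Finset ℕ+) := schreierSucc (atMost 1)

/-- The projection `E x` of a finitely supported sequence `x` to the coordinates in `E`. -/
def proj (E : Finset ℕ+) (x : ℕ+ →₀ ℝ) : ℕ+ →₀ ℝ := x.filter (· ∈ E)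

/-- `E 0 < ⋯ < E (d - 1)`, `d ≥ 1`, are consecutive and the set of their minima is in `F`. -/
def IsAdmissible (F : Set (Finset ℕ+)) {d : ℕ} (E : Fin d → Finset ℕ+) : Prop :=
  0 < d ∧ ∃ h : IsConsecutive E, Finset.univ.image (fun i => (E i).min' (h.nonempty i)) ∈ F

/-- The norms `‖·‖ₙ` on `c₀₀`: `‖·‖₀` is the supremum norm, and `‖x‖ₙ₊₁` is the maximum of `‖x‖ₙ`
and the supremum of `θ ∑ᵢ ‖Eᵢ x‖ₙ` over all admissible `E₁ < ⋯ < E_d`. -/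
def normSeq (θ : ℝ) (F : Set (Finset ℕ+)) : ℕ → (ℕ+ →₀ ℝ) → ℝ
  | 0, x => ⨆ i, |x i|
  | n + 1, x => max (normSeq θ F n x)
      (sSup {r | ∃ (d : ℕ) (E : Fin d → Finset ℕ+), IsAdmissible F E ∧
        r = θ * ∑ i, normSeq θ F n (proj (E i) x)})

/-- The norm `‖x‖ = supₙ ‖x‖ₙ` on `c₀₀`. -/
def tsNorm (θ : ℝ) (F : Set (Finset ℕ+)) (x : ℕ+ →₀ ℝ) : ℝ := ⨆ n, normSeq θ F n x

/-! The next facts show that `tsNorm` is a norm, which is needed to form the completion. -/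

def l1 (x : ℕ+ →₀ ℝ) : ℝ := x.sum fun _ a => |a|

theorem proj_apply (E : Finset ℕ+) (x : ℕ+ →₀ ℝ) (i : ℕ+) :
    proj E x i = if i ∈ E then x i else 0 := by
  simp [proj, Finsupp.filter_apply]

theorem proj_add (E : Finset ℕ+) (x y : ℕ+ →₀ ℝ) : proj E (x + y) = proj E x + proj E y := by
  simp [proj, Finsupp.filter_add]

theorem proj_smul (E : Finset ℕ+) (c : ℝ) (x : ℕ+ →₀ ℝ) : proj E (c • x) = c • proj E x := by
  simp [proj, Finsupp.filter_smul]

theorem bdd_abs (x : ℕ+ →₀ ℝ) : BddAbove (Set.range fun i => |x i|) := by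
  refine ⟨l1 x, ?_⟩
  rintro _ ⟨i, rfl⟩
  by_cases hi : i ∈ x.support
  · exact Finset.single_le_sum (f := fun i => |x i|) (fun _ _ => abs_nonneg _) hi
  · rw [Finsupp.notMem_support_iff] at hi
    simp only [hi, abs_zero]
    exact Finset.sum_nonneg fun _ _ => abs_nonneg _

theorem abs_le_normSeq (θ : ℝ) (F : Set (Finset ℕ+)) (n : ℕ) (x : ℕ+ →₀ ℝ) (i : ℕ+) :
    |x i| ≤ normSeq θ F n x := by
  induction n with
  | zero => exact le_ciSup (bdd_abs x) i
  | succ n ih => exact ih.trans (le_max_left _ _)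

theorem normSeq_nonneg (θ : ℝ) (F : Set (Finset ℕ+)) (n : ℕ) (x : ℕ+ →₀ ℝ) :
    0 ≤ normSeq θ F n x :=
  (abs_nonneg _).trans (abs_le_normSeq θ F n x 1)

theorem abs_le_l1 (x : ℕ+ →₀ ℝ) (i : ℕ+) : |x i| ≤ l1 x := by
  by_cases hi : i ∈ x.support
  · exact Finset.single_le_sum (f := fun i => |x i|) (fun _ _ => abs_nonneg _) hi
  · rw [Finsupp.notMem_support_iff] at hi
    simp only [hi, abs_zero]
    exact Finset.sum_nonneg fun _ _ => abs_nonneg _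

theorem l1_nonneg (x : ℕ+ →₀ ℝ) : 0 ≤ l1 x := Finset.sum_nonneg fun _ _ => abs_nonneg _

theorem l1_proj (E : Finset ℕ+) (x : ℕ+ →₀ ℝ) :
    l1 (proj E x) = ∑ i ∈ x.support, if i ∈ E then |x i| else 0 := by
  rw [l1, Finsupp.sum_of_support_subset (s := x.support)]
  · refine Finset.sum_congr rfl fun i _ => ?_
    rw [proj_apply]
    split_ifs <;> simp
  · simp [proj, Finsupp.support_filter]
  · simp

theorem sum_l1_proj {d : ℕ} {E : Fin d → Finset ℕ+} (h : IsConsecutive E) (x : ℕ+ →₀ ℝ) :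
    ∑ i, l1 (proj (E i) x) ≤ l1 x := by
  simp only [l1_proj]
  rw [Finset.sum_comm, l1]
  refine Finset.sum_le_sum fun k _ => ?_
  by_cases hk : ∃ i, k ∈ E i
  · obtain ⟨i, hi⟩ := hk
    rw [Finset.sum_eq_single i]
    · simp [hi]
    · intro j _ hj
      rw [if_neg]
      intro hkj
      rcases lt_or_gt_of_ne hj with h1 | h1
      · exact lt_irrefl _ (h.lt _ _ h1 k hkj k hi)
      · exact lt_irrefl _ (h.lt _ _ h1 k hi k hkj)
    · simp
  · push Not at hk
    simp [hk]

theorem normSeq_le_l1 {θ : ℝ} (h1 : θ ≤ 1) (F : Set (Finset ℕ+)) (n : ℕ)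
    (x : ℕ+ →₀ ℝ) : normSeq θ F n x ≤ l1 x := by
  induction n generalizing x with
  | zero => exact ciSup_le (abs_le_l1 x)
  | succ n ih =>
    refine max_le (ih x) (Real.sSup_le ?_ (l1_nonneg x))
    rintro _ ⟨d, E, hE, rfl⟩
    obtain ⟨-, hE, -⟩ := hE
    have h2 : ∑ i, normSeq θ F n (proj (E i) x) ≤ l1 x :=
      (Finset.sum_le_sum fun i _ => ih _).trans (sum_l1_proj hE x)
    calc θ * ∑ i, normSeq θ F n (proj (E i) x) ≤ 1 * l1 x :=
          mul_le_mul h1 h2 (Finset.sum_nonneg fun i _ => normSeq_nonneg _ _ _ _) zero_le_one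
      _ = l1 x := one_mul _

theorem bdd_admissible {θ : ℝ} (h1 : θ ≤ 1) (F : Set (Finset ℕ+)) (n : ℕ)
    (x : ℕ+ →₀ ℝ) :
    BddAbove {r | ∃ (d : ℕ) (E : Fin d → Finset ℕ+), IsAdmissible F E ∧
        r = θ * ∑ i, normSeq θ F n (proj (E i) x)} := by
  refine ⟨l1 x, ?_⟩
  rintro _ ⟨d, E, hE, rfl⟩
  obtain ⟨-, hE, -⟩ := hE
  have h2 : ∑ i, normSeq θ F n (proj (E i) x) ≤ l1 x :=
    (Finset.sum_le_sum fun i _ => normSeq_le_l1 h1 F n _).trans (sum_l1_proj hE x)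
  calc θ * ∑ i, normSeq θ F n (proj (E i) x) ≤ 1 * l1 x :=
        mul_le_mul h1 h2 (Finset.sum_nonneg fun i _ => normSeq_nonneg _ _ _ _) zero_le_one
    _ = l1 x := one_mul _

theorem normSeq_add {θ : ℝ} (h0 : 0 ≤ θ) (h1 : θ ≤ 1) (F : Set (Finset ℕ+)) (n : ℕ)
    (x y : ℕ+ →₀ ℝ) : normSeq θ F n (x + y) ≤ normSeq θ F n x + normSeq θ F n y := by
  induction n generalizing x y with
  | zero =>
    refine ciSup_le fun i => ?_
    exact (abs_add_le (x i) (y i)).trans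
      (add_le_add (abs_le_normSeq θ F 0 x i) (abs_le_normSeq θ F 0 y i))
  | succ n ih =>
    refine max_le ((ih x y).trans (add_le_add (le_max_left _ _) (le_max_left _ _)))
      (Real.sSup_le ?_ (add_nonneg (normSeq_nonneg θ F (n + 1) x) (normSeq_nonneg θ F (n + 1) y)))
    rintro _ ⟨d, E, hE, rfl⟩
    have hx : θ * ∑ i, normSeq θ F n (proj (E i) x) ≤ normSeq θ F (n + 1) x :=
      (le_csSup (bdd_admissible h1 F n x) ⟨d, E, hE, rfl⟩).trans (le_max_right _ _)
    have hy : θ * ∑ i, normSeq θ F n (proj (E i) y) ≤ normSeq θ F (n + 1) y :=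
      (le_csSup (bdd_admissible h1 F n y) ⟨d, E, hE, rfl⟩).trans (le_max_right _ _)
    refine le_trans ?_ (add_le_add hx hy)
    rw [← mul_add, ← Finset.sum_add_distrib]
    refine mul_le_mul_of_nonneg_left (Finset.sum_le_sum fun i _ => ?_) h0
    rw [proj_add]
    exact ih _ _

theorem normSeq_smul_le {θ : ℝ} (h0 : 0 ≤ θ) (h1 : θ ≤ 1) (F : Set (Finset ℕ+)) (n : ℕ)
    (c : ℝ) (x : ℕ+ →₀ ℝ) : normSeq θ F n (c • x) ≤ |c| * normSeq θ F n x := by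
  induction n generalizing x with
  | zero =>
    refine ciSup_le fun i => ?_
    rw [Finsupp.smul_apply, smul_eq_mul, abs_mul]
    exact mul_le_mul_of_nonneg_left (abs_le_normSeq θ F 0 x i) (abs_nonneg c)
  | succ n ih =>
    refine max_le ((ih x).trans (mul_le_mul_of_nonneg_left (le_max_left _ _) (abs_nonneg c)))
      (Real.sSup_le ?_ (mul_nonneg (abs_nonneg c) (normSeq_nonneg θ F (n + 1) x)))
    rintro _ ⟨d, E, hE, rfl⟩
    have hx : θ * ∑ i, normSeq θ F n (proj (E i) x) ≤ normSeq θ F (n + 1) x :=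
      (le_csSup (bdd_admissible h1 F n x) ⟨d, E, hE, rfl⟩).trans (le_max_right _ _)
    refine le_trans ?_ (mul_le_mul_of_nonneg_left hx (abs_nonneg c))
    rw [mul_left_comm, Finset.mul_sum (Finset.univ) _ |c|]
    refine mul_le_mul_of_nonneg_left (Finset.sum_le_sum fun i _ => ?_) h0
    rw [proj_smul]
    exact ih _

theorem normSeq_le_tsNorm {θ : ℝ} (h1 : θ ≤ 1) (F : Set (Finset ℕ+)) (n : ℕ)
    (x : ℕ+ →₀ ℝ) : normSeq θ F n x ≤ tsNorm θ F x :=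
  le_ciSup (f := fun n => normSeq θ F n x)
    ⟨l1 x, by rintro _ ⟨n, rfl⟩; exact normSeq_le_l1 h1 F n x⟩ n

theorem tsNorm_add {θ : ℝ} (h0 : 0 ≤ θ) (h1 : θ ≤ 1) (F : Set (Finset ℕ+))
    (x y : ℕ+ →₀ ℝ) : tsNorm θ F (x + y) ≤ tsNorm θ F x + tsNorm θ F y :=
  ciSup_le fun n => (normSeq_add h0 h1 F n x y).trans
    (add_le_add (normSeq_le_tsNorm h1 F n x) (normSeq_le_tsNorm h1 F n y))

theorem tsNorm_smul_le {θ : ℝ} (h0 : 0 ≤ θ) (h1 : θ ≤ 1) (F : Set (Finset ℕ+)) (c : ℝ)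
    (x : ℕ+ →₀ ℝ) : tsNorm θ F (c • x) ≤ |c| * tsNorm θ F x :=
  ciSup_le fun n => (normSeq_smul_le h0 h1 F n c x).trans
    (mul_le_mul_of_nonneg_left (normSeq_le_tsNorm h1 F n x) (abs_nonneg c))

theorem tsNorm_nonneg {θ : ℝ} (h1 : θ ≤ 1) (F : Set (Finset ℕ+))
    (x : ℕ+ →₀ ℝ) : 0 ≤ tsNorm θ F x :=
  (normSeq_nonneg θ F 0 x).trans (normSeq_le_tsNorm h1 F 0 x)

theorem tsNorm_smul {θ : ℝ} (h0 : 0 ≤ θ) (h1 : θ ≤ 1) (F : Set (Finset ℕ+)) (c : ℝ)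
    (x : ℕ+ →₀ ℝ) : tsNorm θ F (c • x) = |c| * tsNorm θ F x := by
  refine le_antisymm (tsNorm_smul_le h0 h1 F c x) ?_
  by_cases hc : c = 0
  · subst hc
    simpa using tsNorm_nonneg h1 F 0
  · have h := tsNorm_smul_le h0 h1 F c⁻¹ (c • x)
    rw [inv_smul_smul₀ hc, abs_inv] at h
    have hc' : 0 < |c| := abs_pos.mpr hc
    calc |c| * tsNorm θ F x ≤ |c| * (|c|⁻¹ * tsNorm θ F (c • x)) :=
          mul_le_mul_of_nonneg_left h hc'.le
      _ = tsNorm θ F (c • x) := by rw [mul_inv_cancel_left₀ hc'.ne']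

theorem eq_zero_of_tsNorm {θ : ℝ} (h1 : θ ≤ 1) (F : Set (Finset ℕ+))
    (x : ℕ+ →₀ ℝ) (h : tsNorm θ F x = 0) : x = 0 := by
  ext i
  have := (abs_le_normSeq θ F 0 x i).trans (normSeq_le_tsNorm h1 F 0 x)
  rw [h] at this
  simpa using this

/-- The space `c₀₀` of finitely supported real sequences `(a₁, a₂, …)`, to be equipped with the
norm of `T[θ, F]`, where `θ ∈ (0, 1/2]`. -/
def C00 (_θ : Set.Ioc (0 : ℝ) (1 / 2)) (_F : Set (Finset ℕ+)) : Type := ℕ+ →₀ ℝ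

instance (θ : Set.Ioc (0 : ℝ) (1 / 2)) (F : Set (Finset ℕ+)) : AddCommGroup (C00 θ F) :=
  inferInstanceAs (AddCommGroup (ℕ+ →₀ ℝ))

instance (θ : Set.Ioc (0 : ℝ) (1 / 2)) (F : Set (Finset ℕ+)) : Module ℝ (C00 θ F) :=
  inferInstanceAs (Module ℝ (ℕ+ →₀ ℝ))

instance (θ : Set.Ioc (0 : ℝ) (1 / 2)) (F : Set (Finset ℕ+)) : Norm (C00 θ F) :=
  ⟨fun x => tsNorm θ F x⟩

theorem normCore (θ : Set.Ioc (0 : ℝ) (1 / 2)) (F : Set (Finset ℕ+)) :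
    NormedSpace.Core ℝ (C00 θ F) := by
  have h0 : 0 ≤ (θ : ℝ) := θ.2.1.le
  have h1 : (θ : ℝ) ≤ 1 := θ.2.2.trans (by norm_num)
  exact
    { norm_nonneg := fun x => tsNorm_nonneg h1 F x
      norm_smul := fun c x => tsNorm_smul h0 h1 F c x
      norm_triangle := fun x y => tsNorm_add h0 h1 F x y
      norm_eq_zero_iff := fun x =>
        ⟨eq_zero_of_tsNorm h1 F x, fun h => by
          subst h
          have := tsNorm_smul h0 h1 F 0 0
          rw [zero_smul, abs_zero, zero_mul] at this
          exact this⟩ }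

instance (θ : Set.Ioc (0 : ℝ) (1 / 2)) (F : Set (Finset ℕ+)) : NormedAddCommGroup (C00 θ F) :=
  NormedAddCommGroup.ofCore (normCore θ F)

instance (θ : Set.Ioc (0 : ℝ) (1 / 2)) (F : Set (Finset ℕ+)) : NormedSpace ℝ (C00 θ F) :=
  NormedSpace.ofCore (normCore θ F)

/-- The combinatorial Tsirelson space `T[θ, F]`: the completion of `c₀₀` for the norm `tsNorm`. -/
abbrev T (θ : Set.Ioc (0 : ℝ) (1 / 2)) (F : Set (Finset ℕ+)) : Type :=
  UniformSpace.Completion (C00 θ F)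

/-- The unit vector `e_i` of `c₀₀`, as an element of `T[θ, F]`. -/
def e (θ : Set.Ioc (0 : ℝ) (1 / 2)) (F : Set (Finset ℕ+)) (i : ℕ+) : T θ F :=
  ((show C00 θ F from Finsupp.single i (1 : ℝ) : C00 θ F) : UniformSpace.Completion (C00 θ F))

end Tsirelson

end

/-!
Let `U` be a linear isometry of `T[θ, 𝒮₁]`. Each `e i` almost spans an `ℓ_∞`-sum with flat vectors
`∑ p ∈ D, c p • e p` of norm one, far out, whose coefficients cancel. The `U (e p)` are bounded, so
infinitely many of them nearly agree on any given initial segment of coordinates, and the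
cancellation moves `U` of the flat vector beyond that segment. Thus `U (e i)` almost spans an
`ℓ_∞`-sum with vectors far out, which can serve as one further set in an admissible sequence; the
room this takes forces the unit vector `U (e i)` to have a coordinate of modulus one, at `π i` say.
As `‖e i ± e j‖ = 1` for `i ≠ j`, the map `π` is injective and the `π i`-th coordinate of `U (e j)`
is zero. Comparing the norms of suitable sums of `π i` unit vectors and of their images gives
`π i ≤ i` or `θ * π i ≤ 1`, so `π` permutes the indices up to `⌊θ⁻¹⌋` and fixes the others.

Conversely, an admissible sequence with at most `⌊θ⁻¹⌋` members is irrelevant to the norm, and a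
longer one does not see the first `⌊θ⁻¹⌋` coordinates; hence these contribute only through their
supremum, which is invariant under permutations.
-/

noncomputable section

namespace Tsirelson

section General

theorem exists_infinite_setOf_dist_lt {ι X : Type*} [Infinite ι] [PseudoMetricSpace X] {K : Set X}
    (hK : IsCompact K) {u : ι → X} (hu : ∀ i, u i ∈ K) {ε : ℝ} (hε : 0 < ε) :
    ∃ c, {i | dist (u i) c < ε}.Infinite := by
  obtain ⟨c, -, hc⟩ := hK.exists_mapClusterPt (f := Filter.cofinite) (u := u)
    (Filter.tendsto_principal.2 (Filter.Eventually.of_forall hu))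
  exact ⟨c, Filter.frequently_cofinite_iff_infinite.1
    (hc.frequently (Metric.ball_mem_nhds c hε))⟩

theorem exists_abs_eq_one_sum_eq_zero {α : Type*} {D : Finset α} (hD : Even D.card) :
    ∃ s : α → ℝ, (∀ p, |s p| = 1) ∧ ∑ p ∈ D, s p = 0 := by
  classical
  obtain ⟨n, hn⟩ := hD
  obtain ⟨B, hBD, hB⟩ := Finset.exists_subset_card_eq (hn ▸ Nat.le_add_left n n)
  refine ⟨fun p => if p ∈ B then 1 else -1, fun p => ?_, ?_⟩
  · dsimp only
    split_ifs <;> simp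
  · rw [← Finset.sum_sdiff hBD, Finset.sum_congr rfl fun p hp => if_neg (Finset.mem_sdiff.1 hp).2,
      Finset.sum_congr rfl fun p hp => if_pos hp, Finset.sum_const, Finset.sum_const,
      Finset.card_sdiff_of_subset hBD, hn, hB, Nat.add_sub_cancel, smul_neg, neg_add_cancel]

theorem norm_sum_smul_le_of_sum_eq_zero {ι X : Type*} [SeminormedAddCommGroup X] [NormedSpace ℝ X]
    {D : Finset ι} {c : ι → ℝ} (hc : ∑ p ∈ D, c p = 0) {u : ι → X} {u₀ : X} {ε : ℝ}
    (hu : ∀ p ∈ D, ‖u p - u₀‖ ≤ ε) : ‖∑ p ∈ D, c p • u p‖ ≤ (∑ p ∈ D, |c p|) * ε := by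
  calc ‖∑ p ∈ D, c p • u p‖ = ‖∑ p ∈ D, c p • (u p - u₀)‖ := by
        simp only [smul_sub, Finset.sum_sub_distrib, ← Finset.sum_smul, hc, zero_smul, sub_zero]
    _ ≤ ∑ p ∈ D, |c p| * ε := norm_sum_le_of_le D fun p hp => by
        rw [norm_smul, Real.norm_eq_abs]
        exact mul_le_mul_of_nonneg_left (hu p hp) (abs_nonneg _)
    _ = (∑ p ∈ D, |c p|) * ε := (Finset.sum_mul ..).symm

theorem surjOn_of_mem_or_le {α : Type*} [Preorder α] {H L : Set α} {π : α → α}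
    (hπ : Function.Injective π) (h : ∀ i, π i ∈ H ∨ π i ≤ i) (hHL : H ⊆ L) (hL : IsLowerSet L)
    (hfin : L.Finite) : Set.SurjOn π L L := by
  have hmaps : Set.MapsTo π L L := fun i hi => (h i).elim (@hHL _) fun hle => hL hle hi
  exact ((hfin.injOn_iff_bijOn_of_mapsTo hmaps).1 hπ.injOn).surjOn

theorem eq_self_of_mem_or_le {α : Type*} [LinearOrder α] [LocallyFiniteOrderBot α] {H : Set α}
    (hH : IsLowerSet H) {π : α → α} (hπ : Function.Injective π) (h : ∀ i, π i ∈ H ∨ π i ≤ i)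
    {i : α} (hi : i ∉ H) : π i = i := by
  have hHi : H ⊆ Set.Iic i := fun j hj => le_of_not_ge fun hij => hi (hH hij hj)
  obtain ⟨j, hji, rfl⟩ :=
    surjOn_of_mem_or_le hπ h hHi (isLowerSet_Iic i) (Set.finite_Iic i) Set.self_mem_Iic
  exact congrArg π (((h j).resolve_left hi).antisymm hji)

theorem surjective_of_mem_or_le {α : Type*} [LinearOrder α] [LocallyFiniteOrderBot α] {H : Set α}
    (hH : IsLowerSet H) (hfin : H.Finite) {π : α → α} (hπ : Function.Injective π)
    (h : ∀ i, π i ∈ H ∨ π i ≤ i) : Function.Surjective π := fun k => by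
  by_cases hk : k ∈ H
  · obtain ⟨j, -, hj⟩ := surjOn_of_mem_or_le hπ h subset_rfl hH hfin hk
    exact ⟨j, hj⟩
  · exact ⟨k, eq_self_of_mem_or_le hH hπ h hk⟩

end General

section Admissible

variable {d : ℕ} {E : Fin d → Finset ℕ+}

theorem IsConsecutive.eq_of_mem (h : IsConsecutive E) {i j : Fin d} {p : ℕ+} (hi : p ∈ E i)
    (hj : p ∈ E j) : i = j := by
  rcases lt_trichotomy i j with hij | hij | hij
  · exact absurd (h.lt i j hij p hi p hj) (lt_irrefl p)
  · exact hij
  · exact absurd (h.lt j i hij p hj p hi) (lt_irrefl p)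

theorem isConsecutive_singleton_iff {f : Fin d → ℕ+} :
    IsConsecutive (fun i => {f i}) ↔ StrictMono f :=
  ⟨fun h i j hij => h.lt i j hij _ (Finset.mem_singleton_self _) _ (Finset.mem_singleton_self _),
    fun h => ⟨fun i => Finset.singleton_nonempty _, fun i j hij => by
      simpa only [SetLT, Finset.mem_singleton, forall_eq] using h hij⟩⟩

theorem IsConsecutive.strictMono_min' (h : IsConsecutive E) :
    StrictMono fun i => (E i).min' (h.nonempty i) :=
  fun i j hij => h.lt i j hij _ (Finset.min'_mem _ _) _ (Finset.min'_mem _ _)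

theorem IsConsecutive.card_image_min' (h : IsConsecutive E) :
    (Finset.univ.image fun i => (E i).min' (h.nonempty i)).card = d := by
  rw [Finset.card_image_of_injective _ h.strictMono_min'.injective, Finset.card_fin]

theorem mem_schreierOne_iff {A : Finset ℕ+} :
    A ∈ schreierOne ↔ ∀ p ∈ A, A.card ≤ (p : ℕ) := by
  constructor
  · rintro (⟨d, G, -, -, hG, hmin, rfl⟩ | rfl) p hp
    · obtain ⟨i, -, hi⟩ := Finset.mem_biUnion.1 hp
      calc (Finset.univ.biUnion G).card ≤ ∑ i, (G i).card := Finset.card_biUnion_le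
        _ ≤ ∑ _i : Fin d, 1 := Finset.sum_le_sum fun i _ => hG i
        _ = d := by simp
        _ ≤ p := hmin i p hi
    · simp
  · intro h
    rcases A.eq_empty_or_nonempty with rfl | hA
    · exact Or.inr rfl
    · refine Or.inl ⟨A.card, fun i => {A.orderEmbOfFin rfl i}, hA.card_pos,
        isConsecutive_singleton_iff.2 (A.orderEmbOfFin rfl).strictMono, fun i => by simp [atMost],
        fun i p hp => h p ?_, ?_⟩
      · rw [Finset.mem_singleton.1 hp]
        exact Finset.orderEmbOfFin_mem A rfl i
      · rw [Finset.biUnion_singleton, ← Finset.coe_inj, Finset.coe_image, Finset.coe_univ,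
          Set.image_univ, Finset.range_orderEmbOfFin]

theorem isAdmissible_schreierOne_iff :
    IsAdmissible schreierOne E ↔ 0 < d ∧ IsConsecutive E ∧ ∀ k, ∀ p ∈ E k, d ≤ (p : ℕ) := by
  refine and_congr_right fun _ => ⟨fun ⟨hE, h⟩ => ⟨hE, fun k p hp => ?_⟩,
    fun ⟨hE, h⟩ => ⟨hE, ?_⟩⟩
  · rw [mem_schreierOne_iff, hE.card_image_min', Finset.forall_mem_image] at h
    exact (h (Finset.mem_univ k)).trans (PNat.coe_le_coe _ _ |>.2 ((E k).min'_le p hp))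
  · rw [mem_schreierOne_iff, hE.card_image_min', Finset.forall_mem_image]
    exact fun k _ => h k _ (Finset.min'_mem _ _)

end Admissible

section FinitelySupported

variable {θ : ℝ} {F : Set (Finset ℕ+)} {x y : ℕ+ →₀ ℝ} {a : ℝ}

theorem abs_proj_apply_le (E : Finset ℕ+) (x : ℕ+ →₀ ℝ) (i : ℕ+) : |proj E x i| ≤ |x i| := by
  rw [proj_apply]
  split_ifs <;> simp

theorem abs_proj_apply_le_abs_proj_apply {E : Finset ℕ+} (h : ∀ i ∈ E, |x i| ≤ |y i|) (i : ℕ+) :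
    |proj E x i| ≤ |proj E y i| := by
  rw [proj_apply, proj_apply]
  split_ifs with hi
  · exact h i hi
  · exact le_rfl

theorem l1_indicator (A : Finset ℕ+) (c : ℕ+ → ℝ) :
    l1 (Finsupp.indicator A fun p _ => c p) = ∑ p ∈ A, |c p| := by
  rw [l1, Finsupp.sum_of_support_subset _ (Finsupp.support_indicator_subset A _) _ (by simp)]
  exact Finset.sum_congr rfl fun p hp => by rw [Finsupp.indicator_of_mem hp]

theorem l1_add_le (x y : ℕ+ →₀ ℝ) : l1 (x + y) ≤ l1 x + l1 y := by
  classical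
  have h0 : ∀ i ∈ x.support ∪ y.support, |(0 : ℝ)| = 0 := fun _ _ => abs_zero
  rw [l1, l1, l1, Finsupp.sum_of_support_subset _ Finsupp.support_add _ h0,
    Finsupp.sum_of_support_subset _ Finset.subset_union_left _ h0,
    Finsupp.sum_of_support_subset _ Finset.subset_union_right _ h0, ← Finset.sum_add_distrib]
  exact Finset.sum_le_sum fun i _ => abs_add_le (x i) (y i)

theorem l1_single (i : ℕ+) (c : ℝ) : l1 (Finsupp.single i c) = |c| := by
  simp [l1]

theorem tendsto_normSeq (h1 : θ ≤ 1) (F : Set (Finset ℕ+)) (x : ℕ+ →₀ ℝ) :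
    Filter.Tendsto (fun n => normSeq θ F n x) Filter.atTop (nhds (tsNorm θ F x)) :=
  tendsto_atTop_ciSup (monotone_nat_of_le_succ fun _ => le_max_left _ _)
    ⟨l1 x, by rintro _ ⟨n, rfl⟩; exact normSeq_le_l1 h1 F n x⟩

theorem abs_le_tsNorm (h1 : θ ≤ 1) (F : Set (Finset ℕ+)) (x : ℕ+ →₀ ℝ) (i : ℕ+) :
    |x i| ≤ tsNorm θ F x :=
  (abs_le_normSeq θ F 0 x i).trans (normSeq_le_tsNorm h1 F 0 x)

theorem tsNorm_le_l1 (h1 : θ ≤ 1) (F : Set (Finset ℕ+)) (x : ℕ+ →₀ ℝ) : tsNorm θ F x ≤ l1 x :=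
  ciSup_le fun n => normSeq_le_l1 h1 F n x

theorem admissible_sum_le_normSeq_succ (h1 : θ ≤ 1) {d : ℕ} {E : Fin d → Finset ℕ+}
    (hE : IsAdmissible F E) (n : ℕ) (x : ℕ+ →₀ ℝ) :
    θ * ∑ k, normSeq θ F n (proj (E k) x) ≤ normSeq θ F (n + 1) x :=
  (le_csSup (bdd_admissible h1 F n x) ⟨d, E, hE, rfl⟩).trans (le_max_right _ _)

theorem admissible_sum_le_tsNorm (h1 : θ ≤ 1) {d : ℕ} {E : Fin d → Finset ℕ+}
    (hE : IsAdmissible F E) (x : ℕ+ →₀ ℝ) :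
    θ * ∑ k, tsNorm θ F (proj (E k) x) ≤ tsNorm θ F x :=
  le_of_tendsto'
    ((tendsto_finsetSum Finset.univ fun _ _ => tendsto_normSeq h1 F _).const_mul θ) fun n =>
    (admissible_sum_le_normSeq_succ h1 hE n x).trans (normSeq_le_tsNorm h1 F (n + 1) x)

theorem normSeq_succ_le {n : ℕ} (hn : normSeq θ F n x ≤ a)
    (hE : ∀ (d : ℕ) (E : Fin d → Finset ℕ+), IsAdmissible F E →
      θ * ∑ k, normSeq θ F n (proj (E k) x) ≤ a) : normSeq θ F (n + 1) x ≤ a := by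
  refine max_le hn (Real.sSup_le ?_ ((normSeq_nonneg θ F n x).trans hn))
  rintro _ ⟨d, E, hadm, rfl⟩
  exact hE d E hadm

theorem tsNorm_le (h0 : 0 ≤ θ) (h1 : θ ≤ 1) (hx : ∀ i, |x i| ≤ a)
    (hE : ∀ (d : ℕ) (E : Fin d → Finset ℕ+), IsAdmissible F E →
      θ * ∑ k, tsNorm θ F (proj (E k) x) ≤ a) : tsNorm θ F x ≤ a := by
  refine ciSup_le fun n => ?_
  induction n with
  | zero => exact ciSup_le hx
  | succ n ih =>
    refine normSeq_succ_le ih fun d E hadm => le_trans ?_ (hE d E hadm)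
    gcongr
    exact normSeq_le_tsNorm h1 F n _

theorem normSeq_le_of_abs_le (h0 : 0 ≤ θ) (h1 : θ ≤ 1) (F : Set (Finset ℕ+)) (n : ℕ)
    (h : ∀ i, |x i| ≤ |y i|) : normSeq θ F n x ≤ normSeq θ F n y := by
  induction n generalizing x y with
  | zero => exact ciSup_le fun i => (h i).trans (abs_le_normSeq θ F 0 y i)
  | succ n ih =>
    refine normSeq_succ_le ((ih h).trans (le_max_left _ _)) fun d E hE =>
      le_trans ?_ (admissible_sum_le_normSeq_succ h1 hE n y)
    gcongr with k
    exact ih (abs_proj_apply_le_abs_proj_apply fun i _ => h i)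

theorem tsNorm_le_of_abs_le (h0 : 0 ≤ θ) (h1 : θ ≤ 1) (F : Set (Finset ℕ+))
    (h : ∀ i, |x i| ≤ |y i|) : tsNorm θ F x ≤ tsNorm θ F y :=
  ciSup_le fun n => (normSeq_le_of_abs_le h0 h1 F n h).trans (normSeq_le_tsNorm h1 F n y)

theorem sum_tsNorm_proj_le_l1 (h1 : θ ≤ 1) (F : Set (Finset ℕ+)) {d : ℕ} {E : Fin d → Finset ℕ+}
    (hE : IsConsecutive E) (x : ℕ+ →₀ ℝ) : ∑ k, tsNorm θ F (proj (E k) x) ≤ l1 x :=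
  (Finset.sum_le_sum fun _ _ => tsNorm_le_l1 h1 F _).trans (sum_l1_proj hE x)

theorem tsNorm_le_max_l1 (h0 : 0 ≤ θ) (h1 : θ ≤ 1) (F : Set (Finset ℕ+))
    (hx : ∀ i, |x i| ≤ a) : tsNorm θ F x ≤ max a (θ * l1 x) :=
  tsNorm_le h0 h1 (fun i => (hx i).trans (le_max_left _ _)) fun _ _ ⟨_, hE, _⟩ =>
    le_max_of_le_right (mul_le_mul_of_nonneg_left (sum_tsNorm_proj_le_l1 h1 F hE x) h0)

theorem tsNorm_le_half_add_l1 (h0 : 0 ≤ θ) (h1 : θ ≤ 1 / 2) (F : Set (Finset ℕ+))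
    (hx : ∀ i, |x i| ≤ a) : tsNorm θ F x ≤ (a + l1 x) / 2 := by
  have hθ : θ ≤ 1 := h1.trans (by norm_num)
  have ha : 0 ≤ a := (abs_nonneg _).trans (hx 1)
  have hl1 := tsNorm_le_l1 hθ F x
  rcases le_max_iff.1 (tsNorm_le_max_l1 h0 hθ F hx) with h | h
  · linarith
  · nlinarith [l1_nonneg x]

theorem sum_tsNorm_proj_le_of_peak (h0 : 0 ≤ θ) (h1 : θ ≤ 1 / 2) (F : Set (Finset ℕ+)) {i : ℕ+}
    {b : ℝ} (hi : |x i| ≤ b) (hx : ∀ p, p ≠ i → |x p| ≤ a) (ha : 0 ≤ a) (hab : a ≤ b) {d : ℕ}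
    {E : Fin d → Finset ℕ+} (hE : IsConsecutive E) {k₀ : Fin d} (hk₀ : i ∈ E k₀) :
    ∑ k, tsNorm θ F (proj (E k) x) ≤ (b + (d - 1) * a + l1 x) / 2 := by
  have hsup : ∀ k p, |proj (E k) x p| ≤ a + if k = k₀ then b - a else 0 := fun k p => by
    rw [proj_apply]
    split_ifs with hpE hk hk
    · rw [add_sub_cancel]
      rcases eq_or_ne p i with rfl | hp
      · exact hi
      · exact (hx p hp).trans hab
    · rw [add_zero]
      refine hx p fun hp => hk (hE.eq_of_mem ?_ hk₀)
      rwa [← hp]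
    · simpa using ha.trans hab
    · simpa using ha
  calc ∑ k, tsNorm θ F (proj (E k) x)
      ≤ ∑ k, ((a + if k = k₀ then b - a else 0) + l1 (proj (E k) x)) / 2 :=
        Finset.sum_le_sum fun k _ => tsNorm_le_half_add_l1 h0 h1 F (hsup k)
    _ = (b + (d - 1) * a + ∑ k, l1 (proj (E k) x)) / 2 := by
        rw [← Finset.sum_div, Finset.sum_add_distrib, Finset.sum_add_distrib, Finset.sum_const,
          Finset.sum_ite_eq', if_pos (Finset.mem_univ _), Finset.card_fin, nsmul_eq_mul]
        ring
    _ ≤ (b + (d - 1) * a + l1 x) / 2 := by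
        gcongr
        exact sum_l1_proj hE x

/-- An admissible sequence of sets that meets `{i}` has at most `i` members, only one of which
sees the peak at `i`. -/
theorem tsNorm_single_add_le (h0 : 0 ≤ θ) (h1 : θ ≤ 1 / 2) {i : ℕ+} (hyi : y i = 0)
    (hy : ∀ p, |y p| ≤ a) (ha : a ≤ 1) :
    tsNorm θ schreierOne (Finsupp.single i 1 + y) ≤
      max (max 1 (θ * l1 y)) (θ * ((2 + ((i : ℕ) - 1) * a + l1 y) / 2)) := by
  have hθ : θ ≤ 1 := h1.trans (by norm_num)
  have ha0 : 0 ≤ a := (abs_nonneg _).trans (hy 1)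
  set x := Finsupp.single i 1 + y with hx
  have hxi : |x i| ≤ 1 := by simp [hx, hyi]
  have hxp : ∀ p, p ≠ i → x p = y p := fun p hp => by simp [hx, Finsupp.single_eq_of_ne hp]
  have hxa : ∀ p, p ≠ i → |x p| ≤ a := fun p hp => hxp p hp ▸ hy p
  have hl1 : l1 x ≤ 1 + l1 y := (l1_add_le _ _).trans_eq (by rw [l1_single, abs_one])
  refine tsNorm_le h0 hθ (fun p => ?_) fun d E hadm => ?_
  · refine le_max_of_le_left (le_max_of_le_left ?_)
    rcases eq_or_ne p i with rfl | hp
    · exact hxi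
    · exact (hxa p hp).trans ha
  obtain ⟨-, hE, hmin⟩ := isAdmissible_schreierOne_iff.1 hadm
  by_cases hmeet : ∃ k, i ∈ E k
  · obtain ⟨k, hk⟩ := hmeet
    have hdi : (d : ℝ) ≤ (i : ℕ) := by exact_mod_cast hmin k i hk
    refine le_max_of_le_right (mul_le_mul_of_nonneg_left ?_ h0)
    calc ∑ k, tsNorm θ schreierOne (proj (E k) x) ≤ (1 + (d - 1) * a + l1 x) / 2 :=
          sum_tsNorm_proj_le_of_peak h0 h1 _ hxi hxa ha0 ha hE hk
      _ ≤ (1 + ((i : ℕ) - 1) * a + (1 + l1 y)) / 2 := by gcongr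
      _ = (2 + ((i : ℕ) - 1) * a + l1 y) / 2 := by ring
  · push Not at hmeet
    refine le_max_of_le_left (le_max_of_le_right (mul_le_mul_of_nonneg_left ?_ h0))
    refine le_trans (Finset.sum_le_sum fun k _ => ?_) (sum_tsNorm_proj_le_l1 hθ schreierOne hE y)
    exact tsNorm_le_of_abs_le h0 hθ _ (abs_proj_apply_le_abs_proj_apply fun p hp =>
      (congrArg abs (hxp p (ne_of_mem_of_not_mem hp (hmeet k)))).le)

theorem normSeq_le_of_head (h0 : 0 ≤ θ) (h1 : θ ≤ 1) {N : ℕ} (hN : θ * N ≤ 1) (n : ℕ)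
    (hhead : ∀ i : ℕ+, (i : ℕ) ≤ N → |x i| ≤ tsNorm θ schreierOne y)
    (htail : ∀ i : ℕ+, N < (i : ℕ) → |x i| ≤ |y i|) :
    normSeq θ schreierOne n x ≤ tsNorm θ schreierOne y := by
  have hy : 0 ≤ tsNorm θ schreierOne y := tsNorm_nonneg h1 _ y
  induction n generalizing x with
  | zero => exact ciSup_le fun i => (le_or_gt (i : ℕ) N).elim (hhead i) fun hi =>
      (htail i hi).trans (abs_le_tsNorm h1 _ y i)
  | succ n ih =>
    refine normSeq_succ_le (ih hhead htail) fun d E hadm => ?_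
    obtain ⟨-, -, hmin⟩ := isAdmissible_schreierOne_iff.1 hadm
    rcases le_or_gt d N with hd | hd
    · calc θ * ∑ k, normSeq θ schreierOne n (proj (E k) x)
          ≤ θ * ∑ _k : Fin d, tsNorm θ schreierOne y := by
            gcongr with k
            exact ih (fun i hi => (abs_proj_apply_le (E k) x i).trans (hhead i hi))
              fun i hi => (abs_proj_apply_le (E k) x i).trans (htail i hi)
        _ = θ * d * tsNorm θ schreierOne y := by simp [mul_assoc]
        _ ≤ θ * N * tsNorm θ schreierOne y := by gcongr
        _ ≤ tsNorm θ schreierOne y := mul_le_of_le_one_left hy hN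
    · refine le_trans ?_ (admissible_sum_le_tsNorm h1 hadm y)
      gcongr with k
      exact (normSeq_le_tsNorm h1 _ n _).trans <| tsNorm_le_of_abs_le h0 h1 _ <|
        abs_proj_apply_le_abs_proj_apply fun i hi => htail i (hd.trans_le (hmin k i hi))

theorem tsNorm_le_of_head (h0 : 0 ≤ θ) (h1 : θ ≤ 1) {N : ℕ} (hN : θ * N ≤ 1)
    (hhead : ∀ i : ℕ+, (i : ℕ) ≤ N → |x i| ≤ tsNorm θ schreierOne y)
    (htail : ∀ i : ℕ+, N < (i : ℕ) → |x i| ≤ |y i|) :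
    tsNorm θ schreierOne x ≤ tsNorm θ schreierOne y :=
  ciSup_le fun n => normSeq_le_of_head h0 h1 hN n hhead htail

end FinitelySupported

section Completion

variable {θ : Set.Ioc (0 : ℝ) (1 / 2)} {F : Set (Finset ℕ+)}

theorem coe_le_one (θ : Set.Ioc (0 : ℝ) (1 / 2)) : (θ : ℝ) ≤ 1 := θ.2.2.trans (by norm_num)

/-- The canonical embedding of `c₀₀` into `T[θ, F]`. -/
def emb (θ : Set.Ioc (0 : ℝ) (1 / 2)) (F : Set (Finset ℕ+)) : (ℕ+ →₀ ℝ) →ₗ[ℝ] T θ F :=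
  (UniformSpace.Completion.toComplₗᵢ (𝕜 := ℝ) (E := C00 θ F)).toLinearMap

theorem norm_emb (y : ℕ+ →₀ ℝ) : ‖emb θ F y‖ = tsNorm θ F y :=
  UniformSpace.Completion.norm_coe (E := C00 θ F) y

theorem emb_single (i : ℕ+) : emb θ F (Finsupp.single i 1) = e θ F i := rfl

theorem denseRange_emb : DenseRange (emb θ F) :=
  UniformSpace.Completion.denseRange_coe (α := C00 θ F)

theorem emb_indicator (A : Finset ℕ+) (c : ℕ+ → ℝ) :
    emb θ F (Finsupp.indicator A fun p _ => c p) = ∑ p ∈ A, c p • e θ F p := by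
  simp only [Finsupp.indicator_eq_sum_single, map_sum, ← emb_single, ← map_smul,
    Finsupp.smul_single_one]

theorem norm_lapply_le (k : ℕ+) (y : ℕ+ →₀ ℝ) :
    ‖(Finsupp.lapply k : (ℕ+ →₀ ℝ) →ₗ[ℝ] ℝ) y‖ ≤ 1 * ‖emb θ F y‖ := by
  rw [one_mul, norm_emb]
  exact abs_le_tsNorm (coe_le_one θ) F y k

/-- The `k`-th coordinate functional on `T[θ, F]`. -/
def coord (θ : Set.Ioc (0 : ℝ) (1 / 2)) (F : Set (Finset ℕ+)) (k : ℕ+) : T θ F →L[ℝ] ℝ :=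
  (Finsupp.lapply k : (ℕ+ →₀ ℝ) →ₗ[ℝ] ℝ).extendOfNorm (emb θ F)

theorem coord_emb (k : ℕ+) (y : ℕ+ →₀ ℝ) : coord θ F k (emb θ F y) = y k :=
  LinearMap.extendOfNorm_eq denseRange_emb ⟨1, norm_lapply_le k⟩ y

theorem abs_coord_le (k : ℕ+) (x : T θ F) : |coord θ F k x| ≤ ‖x‖ :=
  (LinearMap.norm_extendOfNorm_apply_le denseRange_emb 1 (norm_lapply_le k) x).trans_eq (one_mul _)

theorem coord_e (k i : ℕ+) : coord θ F k (e θ F i) = if i = k then 1 else 0 := by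
  rw [← emb_single, coord_emb, Finsupp.single_apply]

theorem norm_e (i : ℕ+) : ‖e θ F i‖ = 1 := by
  refine le_antisymm ?_ ?_
  · rw [← emb_single, norm_emb]
    exact (tsNorm_le_l1 (coe_le_one θ) F _).trans_eq (by rw [l1_single, abs_one])
  · simpa [coord_e] using abs_coord_le i (e θ F i)

open Classical in
/-- The restriction of finitely supported sequences to the coordinates in `S`, as a linear map. -/
def filterₗ (S : Set ℕ+) : (ℕ+ →₀ ℝ) →ₗ[ℝ] ℕ+ →₀ ℝ :=
  (Finsupp.supported ℝ ℝ S).subtype ∘ₗ Finsupp.restrictDom ℝ ℝ S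

theorem coe_filterₗ (S : Set ℕ+) (y : ℕ+ →₀ ℝ) : ⇑(filterₗ S y) = S.indicator y := by
  classical exact Finsupp.filter_eq_indicator _ _

theorem filterₗ_coe (E : Finset ℕ+) (y : ℕ+ →₀ ℝ) : filterₗ (E : Set ℕ+) y = proj E y := by
  ext k
  simp only [coe_filterₗ, proj_apply, Set.indicator_apply, Finset.mem_coe]

theorem norm_emb_filterₗ_le (S : Set ℕ+) (y : ℕ+ →₀ ℝ) :
    ‖(emb θ F ∘ₗ filterₗ S) y‖ ≤ 1 * ‖emb θ F y‖ := by
  rw [one_mul, LinearMap.comp_apply, norm_emb, norm_emb]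
  refine tsNorm_le_of_abs_le θ.2.1.le (coe_le_one θ) F fun k => ?_
  rw [coe_filterₗ, ← Real.norm_eq_abs]
  exact norm_indicator_le_norm_self _ _

/-- The restriction `x ↦ Sx` of the elements of `T[θ, F]` to the coordinates in `S`, where `S` need
not be finite. -/
def restrict (S : Set ℕ+) : T θ F →L[ℝ] T θ F :=
  (emb θ F ∘ₗ filterₗ S).extendOfNorm (emb θ F)

theorem restrict_emb (S : Set ℕ+) (y : ℕ+ →₀ ℝ) :
    restrict S (emb θ F y) = emb θ F (filterₗ S y) :=
  LinearMap.extendOfNorm_eq denseRange_emb ⟨1, norm_emb_filterₗ_le S⟩ y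

theorem norm_restrict_le (S : Set ℕ+) (x : T θ F) : ‖restrict S x‖ ≤ ‖x‖ :=
  (LinearMap.norm_extendOfNorm_apply_le denseRange_emb 1 (norm_emb_filterₗ_le S) x).trans_eq
    (one_mul _)

theorem clm_ext_emb {G : Type*} [TopologicalSpace G] [T2Space G] [AddCommMonoid G] [Module ℝ G]
    {f g : T θ F →L[ℝ] G} (h : ∀ y, f (emb θ F y) = g (emb θ F y)) : f = g :=
  ContinuousLinearMap.ext fun x =>
    congrFun (denseRange_emb.equalizer f.continuous g.continuous (funext h)) x

theorem restrict_restrict (S S' : Set ℕ+) (x : T θ F) :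
    restrict S (restrict S' x) = restrict (S ∩ S') x := by
  refine DFunLike.congr_fun (f := restrict S ∘L restrict S') (clm_ext_emb fun y => ?_) x
  simp only [ContinuousLinearMap.comp_apply, restrict_emb]
  congr 1
  exact DFunLike.coe_injective (by simp only [coe_filterₗ, Set.indicator_indicator])

theorem restrict_add_restrict_compl (S : Set ℕ+) (x : T θ F) :
    restrict S x + restrict Sᶜ x = x := by
  refine DFunLike.congr_fun (f := restrict S + restrict Sᶜ) (g := .id ℝ _)
    (clm_ext_emb fun y => ?_) x
  simp only [add_apply, restrict_emb, ← map_add, ContinuousLinearMap.id_apply]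
  congr 1
  exact DFunLike.coe_injective (by
    simp only [Finsupp.coe_add, coe_filterₗ, Set.indicator_self_add_compl])

theorem coord_restrict (S : Set ℕ+) (k : ℕ+) (x : T θ F) :
    coord θ F k (restrict S x) = S.indicator (fun j => coord θ F j x) k := by
  classical
  refine (DFunLike.congr_fun (f := coord θ F k ∘L restrict S)
    (g := if k ∈ S then coord θ F k else 0) (clm_ext_emb fun y => ?_) x).trans ?_
  · rw [ContinuousLinearMap.comp_apply, restrict_emb, coord_emb, coe_filterₗ, Set.indicator_apply]
    split_ifs
    · rw [coord_emb]
    · rfl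
  · rw [Set.indicator_apply]
    split_ifs <;> rfl

theorem restrict_coe (E : Finset ℕ+) (x : T θ F) :
    restrict (E : Set ℕ+) x = ∑ k ∈ E, coord θ F k x • e θ F k := by
  refine DFunLike.congr_fun (g := ∑ k ∈ E, (coord θ F k).smulRight (e θ F k))
    (clm_ext_emb fun y => ?_) x |>.trans (by simp)
  simp only [restrict_emb, sum_apply, ContinuousLinearMap.smulRight_apply, coord_emb,
    ← emb_indicator]
  congr 1
  ext k
  simp only [filterₗ_coe, proj_apply, Finsupp.indicator_apply, dite_eq_ite]

theorem restrict_empty (x : T θ F) : restrict ∅ x = 0 := by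
  rw [← Finset.coe_empty, restrict_coe, Finset.sum_empty]

theorem restrict_univ (x : T θ F) : restrict Set.univ x = x := by
  simpa only [Set.compl_univ, restrict_empty, add_zero] using
    restrict_add_restrict_compl Set.univ x

theorem norm_restrict_mono {S S' : Set ℕ+} (h : S ⊆ S') (x : T θ F) :
    ‖restrict S x‖ ≤ ‖restrict S' x‖ := by
  rw [← Set.inter_eq_left.2 h, ← restrict_restrict]
  exact norm_restrict_le S _

theorem abs_coord_le_norm_restrict {S : Set ℕ+} {k : ℕ+} (hk : k ∈ S) (x : T θ F) :
    |coord θ F k x| ≤ ‖restrict S x‖ := by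
  simpa only [coord_restrict, Set.indicator_of_mem hk] using abs_coord_le k (restrict S x)

theorem exists_forall_norm_restrict_lt (x : T θ F) {η : ℝ} (hη : 0 < η) :
    ∃ m : ℕ+, ∀ S ⊆ Set.Ici m, ‖restrict S x‖ < η := by
  obtain ⟨y, hy⟩ := denseRange_emb.exists_dist_lt (f := emb θ F) x hη
  obtain ⟨m, hm⟩ := y.support.bddAbove
  refine ⟨m + 1, fun S hS => ?_⟩
  have hzero : restrict S (emb θ F y) = 0 := by
    rw [restrict_emb, ← map_zero (emb θ F)]
    congr 1
    ext k
    rw [coe_filterₗ, Finsupp.zero_apply]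
    refine Set.indicator_apply_eq_zero.2 fun hk => Finsupp.notMem_support_iff.1 fun hky => ?_
    exact (PNat.lt_add_one_iff.2 (hm hky)).not_ge (hS hk)
  calc ‖restrict S x‖ = ‖restrict S (x - emb θ F y)‖ := by rw [map_sub, hzero, sub_zero]
    _ ≤ ‖x - emb θ F y‖ := norm_restrict_le S _
    _ < η := by rwa [← dist_eq_norm]

theorem ext_coord {x y : T θ F} (h : ∀ k, coord θ F k x = coord θ F k y) : x = y := by
  rw [← sub_eq_zero, ← norm_le_zero_iff]
  refine le_of_forall_pos_le_add fun η hη => ?_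
  obtain ⟨m, hm⟩ := exists_forall_norm_restrict_lt (x - y) hη
  have hhead : restrict (Set.Iio m) (x - y) = 0 := by
    rw [← Finset.coe_Iio, restrict_coe]
    exact Finset.sum_eq_zero fun k _ => by rw [map_sub, h, sub_self, zero_smul]
  rw [← restrict_add_restrict_compl (Set.Iio m) (x - y), hhead, zero_add, zero_add, Set.compl_Iio]
  exact (hm _ subset_rfl).le

theorem exists_forall_abs_coord_le (x : T θ F) :
    ∃ k, ∀ j, |coord θ F j x| ≤ |coord θ F k x| := by
  by_cases! h : ∃ j, coord θ F j x ≠ 0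
  · obtain ⟨j, hj⟩ := h
    obtain ⟨m, hm⟩ := exists_forall_norm_restrict_lt x (abs_pos.2 hj)
    have hsmall : ∀ i, m ≤ i → |coord θ F i x| < |coord θ F j x| := fun i hi =>
      (abs_coord_le_norm_restrict (S := Set.Ici m) hi x).trans_lt (hm _ subset_rfl)
    have hjm : j ∈ Finset.Iio m :=
      Finset.mem_Iio.2 (not_le.1 fun hle => (hsmall j hle).false)
    obtain ⟨k, -, hk⟩ :=
      (Finset.Iio m).exists_max_image (fun i => |coord θ F i x|) ⟨j, hjm⟩
    exact ⟨k, fun i => (lt_or_ge i m).elim (fun hi => hk i (Finset.mem_Iio.2 hi)) fun hi =>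
      (hsmall i hi).le.trans (hk j hjm)⟩
  · exact ⟨1, fun j => by rw [h j, h 1]⟩

theorem admissible_sum_le_norm {d : ℕ} {E : Fin d → Finset ℕ+} (hE : IsAdmissible F E)
    (x : T θ F) : θ * ∑ k, ‖restrict (E k : Set ℕ+) x‖ ≤ ‖x‖ := by
  refine denseRange_emb.induction_on x (isClosed_le (by fun_prop) (by fun_prop)) fun y => ?_
  simp only [restrict_emb, filterₗ_coe, norm_emb]
  exact admissible_sum_le_tsNorm (coe_le_one θ) hE y

theorem norm_le_of_admissible {x : T θ F} {a : ℝ} (hx : ∀ k, |coord θ F k x| ≤ a)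
    (hE : ∀ (d : ℕ) (E : Fin d → Finset ℕ+), IsAdmissible F E →
      θ * ∑ k, ‖restrict (E k : Set ℕ+) x‖ ≤ a) : ‖x‖ ≤ a := by
  have h0 : (0 : ℝ) ≤ θ := θ.2.1.le
  refine le_of_forall_pos_le_add fun η hη => ?_
  obtain ⟨y, hy⟩ := denseRange_emb.exists_dist_lt (f := emb θ F) x (half_pos hη)
  rw [dist_eq_norm, norm_sub_rev] at hy
  set z := emb θ F y - x with hz
  have hyz : emb θ F y = x + z := by rw [hz, add_sub_cancel]
  have hnorm : ‖emb θ F y‖ ≤ a + η / 2 := by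
    rw [norm_emb]
    refine tsNorm_le h0 (coe_le_one θ) (fun k => ?_) fun d E hadm => ?_
    · rw [← coord_emb (θ := θ) (F := F), hyz, map_add]
      exact (abs_add_le _ _).trans (add_le_add (hx k) ((abs_coord_le k z).trans hy.le))
    · simp only [← norm_emb, ← filterₗ_coe, ← restrict_emb, hyz, map_add]
      calc (θ : ℝ) * ∑ k, ‖restrict (E k : Set ℕ+) x + restrict (E k : Set ℕ+) z‖
          ≤ θ * ∑ k, (‖restrict (E k : Set ℕ+) x‖ + ‖restrict (E k : Set ℕ+) z‖) := by
            gcongr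
            exact norm_add_le _ _
        _ = θ * ∑ k, ‖restrict (E k : Set ℕ+) x‖ + θ * ∑ k, ‖restrict (E k : Set ℕ+) z‖ := by
            rw [Finset.sum_add_distrib, mul_add]
        _ ≤ a + η / 2 :=
            add_le_add (hE d E hadm) ((admissible_sum_le_norm hadm z).trans hy.le)
  calc ‖x‖ = ‖emb θ F y - z‖ := by rw [hyz, add_sub_cancel_right]
    _ ≤ ‖emb θ F y‖ + ‖z‖ := norm_sub_le _ _
    _ ≤ a + η / 2 + η / 2 := add_le_add hnorm hy.le
    _ = a + η := by ring

end Completion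

section Schreier

variable {θ : Set.Ioc (0 : ℝ) (1 / 2)}

theorem sum_norm_restrict_le {d : ℕ} {S : Fin d → Set ℕ+} (hne : ∀ k, (S k).Nonempty)
    (hlt : ∀ k l, k < l → ∀ p ∈ S k, ∀ q ∈ S l, p < q) (hmin : ∀ k, ∀ p ∈ S k, d ≤ (p : ℕ))
    (x : T θ schreierOne) : θ * ∑ k, ‖restrict (S k) x‖ ≤ ‖x‖ := by
  classical
  rcases d.eq_zero_or_pos with rfl | hd
  · simp
  refine denseRange_emb.induction_on x (isClosed_le (by fun_prop) (by fun_prop)) fun y => ?_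
  choose p hp using hne
  let E : Fin d → Finset ℕ+ := fun k => insert (p k) (y.support.filter (· ∈ S k))
  have hES : ∀ k, ∀ q ∈ E k, q ∈ S k := fun k q hq => by
    rcases Finset.mem_insert.1 hq with rfl | hq
    · exact hp k
    · exact (Finset.mem_filter.1 hq).2
  have hadm : IsAdmissible schreierOne E := isAdmissible_schreierOne_iff.2
    ⟨hd, ⟨fun k => Finset.insert_nonempty _ _, fun k l hkl q hq r hr =>
      hlt k l hkl q (hES k q hq) r (hES l r hr)⟩, fun k q hq => hmin k q (hES k q hq)⟩
  have hproj : ∀ k, filterₗ (S k) y = proj (E k) y := fun k => by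
    ext q
    rw [coe_filterₗ, Set.indicator_apply, proj_apply]
    by_cases hq : y q = 0
    · simp only [hq, ite_self]
    · exact if_congr ⟨fun h => Finset.mem_insert_of_mem (by simp [hq, h]), hES k q⟩ rfl rfl
  simp only [restrict_emb, hproj, norm_emb]
  exact admissible_sum_le_tsNorm (coe_le_one θ) hadm y

theorem sum_norm_restrict_add_Ici_le {d : ℕ} {E : Fin d → Finset ℕ+} (hE : IsConsecutive E)
    (hmin : ∀ k, ∀ p ∈ E k, d + 1 ≤ (p : ℕ)) {m : ℕ+} (hm : d + 1 ≤ (m : ℕ))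
    (hEm : ∀ k, ∀ p ∈ E k, p < m) (x : T θ schreierOne) :
    θ * (∑ k, ‖restrict (E k : Set ℕ+) x‖ + ‖restrict (Set.Ici m) x‖) ≤ ‖x‖ := by
  let S : Fin (d + 1) → Set ℕ+ := Fin.snoc (fun k => (E k : Set ℕ+)) (Set.Ici m)
  have hS : ∀ k : Fin d, S k.castSucc = E k := fun k => Fin.snoc_castSucc (α := fun _ => Set ℕ+) ..
  have hSlast : S (Fin.last d) = Set.Ici m := Fin.snoc_last (α := fun _ => Set ℕ+) ..
  have h := sum_norm_restrict_le (S := S)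
    (Fin.forall_fin_succ'.2 ⟨fun k => hS k ▸ hE.nonempty k, hSlast ▸ Set.nonempty_Ici⟩)
    (fun k l hkl p hp q hq => ?_)
    (Fin.forall_fin_succ'.2 ⟨fun k => hS k ▸ hmin k, hSlast ▸ fun p hp => hm.trans hp⟩) x
  · simpa only [Fin.sum_univ_castSucc, hS, hSlast] using h
  · induction k using Fin.lastCases with
    | last => exact absurd hkl (Fin.le_last l).not_gt
    | cast k =>
      rw [hS] at hp
      induction l using Fin.lastCases with
      | last =>
        rw [hSlast] at hq
        exact (hEm k p hp).trans_le hq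
      | cast l =>
        rw [hS] at hq
        exact hE.lt k l (Fin.castSucc_lt_castSucc_iff.1 hkl) p hp q hq

theorem sum_abs_coord_le {A : Finset ℕ+} (hA : ∀ p ∈ A, A.card ≤ (p : ℕ))
    (x : T θ schreierOne) : θ * ∑ k ∈ A, |coord θ schreierOne k x| ≤ ‖x‖ := by
  have h0 : (0 : ℝ) ≤ θ := θ.2.1.le
  let f := A.orderEmbOfFin rfl
  calc θ * ∑ k ∈ A, |coord θ schreierOne k x| = θ * ∑ i, |coord θ schreierOne (f i) x| := by
        conv_lhs => rw [← A.map_orderEmbOfFin_univ rfl, Finset.sum_map]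
        rfl
    _ ≤ θ * ∑ i, ‖restrict {f i} x‖ := by
        gcongr
        exact abs_coord_le_norm_restrict (Set.mem_singleton _) x
    _ ≤ ‖x‖ := sum_norm_restrict_le (fun i => Set.singleton_nonempty _)
        (by simp [f])
        (fun i p hp => hp ▸ hA _ (A.orderEmbOfFin_mem rfl i)) x

theorem abs_indicator_le {A : Finset ℕ+} {c : ℕ+ → ℝ} {a : ℝ} (ha : 0 ≤ a)
    (hc : ∀ p ∈ A, |c p| ≤ a) (k : ℕ+) : |Finsupp.indicator A (fun p _ => c p) k| ≤ a := by
  rw [Finsupp.indicator_apply]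
  split_ifs with hk
  · exact hc k hk
  · simpa using ha

theorem norm_sum_smul_e_le {F : Set (Finset ℕ+)} {A : Finset ℕ+} {c : ℕ+ → ℝ} {a : ℝ}
    (ha : 0 ≤ a) (hc : ∀ p ∈ A, |c p| ≤ a) :
    ‖∑ p ∈ A, c p • e θ F p‖ ≤ max a (θ * ∑ p ∈ A, |c p|) := by
  rw [← emb_indicator, norm_emb, ← l1_indicator]
  exact tsNorm_le_max_l1 θ.2.1.le (coe_le_one θ) F (abs_indicator_le ha hc)

theorem norm_e_add_sum_smul_e_le {A : Finset ℕ+} {c : ℕ+ → ℝ} {a : ℝ} (ha : 0 ≤ a) (ha1 : a ≤ 1)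
    (hc : ∀ p ∈ A, |c p| ≤ a) {i : ℕ+} (hi : i ∉ A) :
    ‖e θ schreierOne i + ∑ p ∈ A, c p • e θ schreierOne p‖ ≤
      max (max 1 (θ * ∑ p ∈ A, |c p|))
        (θ * ((2 + ((i : ℕ) - 1) * a + ∑ p ∈ A, |c p|) / 2)) := by
  rw [← emb_indicator, ← emb_single, ← map_add, norm_emb, ← l1_indicator]
  exact tsNorm_single_add_le θ.2.1.le θ.2.2 (Finsupp.indicator_of_notMem hi _)
    (abs_indicator_le ha hc) ha1

end Schreier

section LinftyAtInfinity

variable {θ : Set.Ioc (0 : ℝ) (1 / 2)} {x : T θ schreierOne}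

/-- There are unit vectors `v`, almost supported arbitrarily far out, for which `‖x + v‖` is close
to `1`, as for disjointly supported unit vectors of `ℓ_∞`. For a unit vector `x` this excludes mass
spread over many coordinates. -/
def IsLinftyAtInfinity {F : Set (Finset ℕ+)} (x : T θ F) : Prop :=
  ∀ η > 0, ∀ m : ℕ+, ∃ v : T θ F, ‖v‖ = 1 ∧ ‖x + v‖ ≤ 1 + η ∧ ‖restrict (Set.Iio m) v‖ ≤ η

/-- The far unit vector `v` supplies one more set to an admissible sequence for `x + v`. -/
theorem IsLinftyAtInfinity.sum_norm_restrict_le (hx : IsLinftyAtInfinity x) {d : ℕ}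
    {E : Fin d → Finset ℕ+} (hE : IsConsecutive E) (hmin : ∀ k, ∀ p ∈ E k, d + 1 ≤ (p : ℕ)) :
    θ * ∑ k, ‖restrict (E k : Set ℕ+) x‖ ≤ 1 - θ := by
  refine le_of_forall_pos_le_add fun δ hδ => ?_
  obtain ⟨η, hη, hηδ⟩ : ∃ η > 0, (d + 3 : ℝ) * η = δ :=
    ⟨δ / (d + 3), by positivity, mul_div_cancel₀ _ (by positivity)⟩
  obtain ⟨m₀, hm₀⟩ := exists_forall_norm_restrict_lt x hη
  obtain ⟨m₁, hm₁⟩ := (Finset.univ.biUnion E).bddAbove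
  obtain ⟨m, hm, hm'⟩ : ∃ m : ℕ+, d + 1 ≤ (m : ℕ) ∧ m₀ ≤ m ∧ m₁ < m :=
    ⟨max d.succPNat (max m₀ (m₁ + 1)), PNat.coe_le_coe _ _ |>.2 (le_max_left d.succPNat _),
      le_max_of_le_right (le_max_left _ _),
      (PNat.lt_add_right m₁ 1).trans_le (le_max_of_le_right (le_max_right _ _))⟩
  have hEm : ∀ k, ∀ p ∈ E k, p < m := fun k p hp =>
    (hm₁ (Finset.mem_biUnion.2 ⟨k, Finset.mem_univ k, hp⟩)).trans_lt hm'.2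
  obtain ⟨v, hv1, hxv, hv⟩ := hx η hη m
  have hhead : ∀ k, ‖restrict (E k : Set ℕ+) x‖ - η ≤ ‖restrict (E k : Set ℕ+) (x + v)‖ :=
    fun k => by
      have hvk := (norm_restrict_mono (hEm k) v).trans hv
      rw [map_add]
      linarith [norm_sub_le_norm_add (restrict (E k : Set ℕ+) x) (restrict (E k : Set ℕ+) v)]
  have htail : 1 - 2 * η ≤ ‖restrict (Set.Ici m) (x + v)‖ := by
    have hv' : ‖v‖ ≤ ‖restrict (Set.Iio m) v‖ + ‖restrict (Set.Ici m) v‖ := by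
      rw [← Set.compl_Iio]
      exact (congrArg norm (restrict_add_restrict_compl (Set.Iio m) v)).ge.trans (norm_add_le _ _)
    rw [map_add, add_comm]
    linarith [norm_sub_le_norm_add (restrict (Set.Ici m) v) (restrict (Set.Ici m) x),
      hm₀ _ (Set.Ici_subset_Ici.2 hm'.1)]
  have hsum := (sum_norm_restrict_add_Ici_le hE hmin hm hEm (x + v)).trans hxv
  have hx_le : ∑ k, ‖restrict (E k : Set ℕ+) x‖ ≤
      ∑ k, ‖restrict (E k : Set ℕ+) (x + v)‖ + d * η := by
    rw [← sub_le_iff_le_add]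
    simpa [Finset.sum_sub_distrib] using Finset.sum_le_sum fun k (_ : k ∈ Finset.univ) => hhead k
  calc (θ : ℝ) * ∑ k, ‖restrict (E k : Set ℕ+) x‖
      ≤ θ * (∑ k, ‖restrict (E k : Set ℕ+) (x + v)‖ + ‖restrict (Set.Ici m) (x + v)‖
          + ((d + 2) * η - 1)) :=
        mul_le_mul_of_nonneg_left (by linarith) θ.2.1.le
    _ ≤ 1 + η + (1 * ((d + 2) * η) - θ) := by
        rw [mul_add, mul_sub, mul_one]
        gcongr
        exact coe_le_one θ
    _ = 1 - θ + δ := by rw [← hηδ]; ring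

theorem exists_norm_restrict_Ioi_lt {F : Set (Finset ℕ+)} {x : T θ F} (hx : x ≠ 0) :
    ∃ M : ℕ+, ‖x‖ ≤ ‖restrict (Set.Ici M) x‖ ∧ ‖restrict (Set.Ioi M) x‖ < ‖x‖ := by
  by_contra! h
  have hall : ∀ M : ℕ+, ‖x‖ ≤ ‖restrict (Set.Ici M) x‖ := fun M => by
    induction M with
    | one => rw [← PNat.bot_eq_one, Set.Ici_bot, restrict_univ]
    | succ M ih =>
      rw [← Order.succ_eq_add_one, Order.Ici_succ]
      exact h M ih
  obtain ⟨m, hm⟩ := exists_forall_norm_restrict_lt x (norm_pos_iff.2 hx)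
  exact (hm _ subset_rfl).not_ge (hall m)

/-- If `M` belongs to the last of the sets, then the earlier ones do not see `x` restricted to
`[M, ∞)`; otherwise the last one sees only `(M, ∞)`, and the earlier ones leave room for a far unit
vector. -/
theorem IsLinftyAtInfinity.sum_norm_restrict_Ici_le (hx : IsLinftyAtInfinity x) (hx1 : ‖x‖ ≤ 1)
    (M : ℕ+) {d : ℕ} {E : Fin d → Finset ℕ+} (hE : IsAdmissible schreierOne E) :
    θ * ∑ k, ‖restrict (E k : Set ℕ+) (restrict (Set.Ici M) x)‖ ≤
      max (1 / 2) (1 - θ * (1 - ‖restrict (Set.Ioi M) x‖)) := by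
  obtain ⟨hd, hE, hmin⟩ := isAdmissible_schreierOne_iff.1 hE
  obtain ⟨d, rfl⟩ := Nat.exists_eq_add_one.2 hd
  simp only [restrict_restrict, Fin.sum_univ_castSucc]
  by_cases hM : M ∈ E (Fin.last d)
  · refine le_max_of_le_left ?_
    have hempty : ∀ k : Fin d, (E k.castSucc : Set ℕ+) ∩ Set.Ici M = ∅ := fun k =>
      Set.eq_empty_of_forall_notMem fun p hp =>
        (hE.lt _ _ k.castSucc_lt_last p hp.1 M hM).not_ge hp.2
    simp only [hempty, restrict_empty, norm_zero, Finset.sum_const_zero, zero_add]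
    exact (mul_le_of_le_one_right θ.2.1.le ((norm_restrict_le _ x).trans hx1)).trans θ.2.2
  · refine le_max_of_le_right ?_
    have hinit := hx.sum_norm_restrict_le (E := fun k => E k.castSucc)
      ⟨fun k => hE.nonempty _, fun k l hkl => hE.lt _ _ (Fin.castSucc_lt_castSucc_iff.2 hkl)⟩
      fun k => hmin k.castSucc
    have hsub : (E (Fin.last d) : Set ℕ+) ∩ Set.Ici M ⊆ Set.Ioi M := by
      rintro p ⟨hpE, hp⟩
      exact lt_of_le_of_ne hp (ne_of_mem_of_not_mem hpE hM).symm
    have hlast : ‖restrict ((E (Fin.last d) : Set ℕ+) ∩ Set.Ici M) x‖ ≤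
        ‖restrict (Set.Ioi M) x‖ :=
      norm_restrict_mono hsub x
    have hinit' : ∑ k : Fin d, ‖restrict ((E k.castSucc : Set ℕ+) ∩ Set.Ici M) x‖ ≤
        ∑ k : Fin d, ‖restrict (E k.castSucc : Set ℕ+) x‖ :=
      Finset.sum_le_sum fun k _ => norm_restrict_mono Set.inter_subset_left x
    nlinarith [θ.2.1]

theorem IsLinftyAtInfinity.exists_abs_coord_eq_one (hx : IsLinftyAtInfinity x) (hx1 : ‖x‖ = 1) :
    ∃ k, |coord θ schreierOne k x| = 1 := by
  obtain ⟨M, hM, hM'⟩ := exists_norm_restrict_Ioi_lt (norm_ne_zero_iff.1 (hx1 ▸ one_ne_zero))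
  rw [hx1] at hM hM'
  obtain ⟨k, hk⟩ := exists_forall_abs_coord_le (restrict (Set.Ici M) x)
  refine ⟨k, le_antisymm (hx1 ▸ abs_coord_le k x) (not_lt.1 fun hlt => ?_)⟩
  have hkx : |coord θ schreierOne k (restrict (Set.Ici M) x)| < 1 := by
    rw [coord_restrict, Set.indicator_apply]
    split_ifs
    · exact hlt
    · exact abs_zero.trans_lt zero_lt_one
  refine hM.not_gt (lt_of_le_of_lt (norm_le_of_admissible
    (fun j => (hk j).trans (le_max_left _ _)) fun d E hE =>
      (hx.sum_norm_restrict_Ici_le hx1.le M hE).trans (le_max_right _ _))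
    (max_lt hkx (max_lt one_half_lt_one ?_)))
  nlinarith [θ.2.1]

end LinftyAtInfinity

section FlatVectors

variable {θ : Set.Ioc (0 : ℝ) (1 / 2)} {A : Finset ℕ+} {c : ℕ+ → ℝ} {a : ℝ}

theorem isCompactOperator_restrict {F : Set (Finset ℕ+)} (E : Finset ℕ+) :
    IsCompactOperator (restrict (E : Set ℕ+) : T θ F →L[ℝ] T θ F) := by
  have hsum : ⇑(restrict (E : Set ℕ+) : T θ F →L[ℝ] T θ F) =
      ∑ k ∈ E, fun x => coord θ F k x • e θ F k := by
    ext1 x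
    rw [restrict_coe, Finset.sum_apply]
  rw [hsum]
  refine Finset.sum_induction _ IsCompactOperator (fun _ _ => .add) isCompactOperator_zero
    fun k _ => ?_
  exact (isCompactOperator_of_locallyCompactSpace_dom (coord θ F k)).continuous_comp
    (g := fun t : ℝ => t • e θ F k) (by fun_prop)

theorem exists_infinite_setOf_norm_sub_lt {F : Set (Finset ℕ+)} {X : Type*}
    [NormedAddCommGroup X] [NormedSpace ℝ X] {K : T θ F →L[ℝ] X} (hK : IsCompactOperator K)
    {ε : ℝ} (hε : 0 < ε) : ∃ c, {i | ‖K (e θ F i) - c‖ < ε}.Infinite := by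
  simp only [← dist_eq_norm]
  refine exists_infinite_setOf_dist_lt
    (IsCompactOperator.isCompact_closure_image_closedBall (f := K.toLinearMap) hK 1)
    (fun i => subset_closure (Set.mem_image_of_mem _ ?_)) hε
  rw [mem_closedBall_zero_iff, norm_e]

theorem coord_sum_smul_e {F : Set (Finset ℕ+)} {k : ℕ+} (hk : k ∈ A) (c : ℕ+ → ℝ) :
    coord θ F k (∑ p ∈ A, c p • e θ F p) = c k := by
  rw [← emb_indicator, coord_emb, Finsupp.indicator_of_mem hk]

theorem mul_sum_abs_eq_one (hc : ∀ p ∈ A, |c p| = a) (hcard : (θ : ℝ) * (A.card * a) = 1) :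
    θ * ∑ p ∈ A, |c p| = 1 := by
  rw [Finset.sum_congr rfl hc, Finset.sum_const, nsmul_eq_mul, hcard]

theorem norm_sum_smul_e_eq_one (hA : ∀ p ∈ A, A.card ≤ (p : ℕ)) (ha : 0 ≤ a) (ha1 : a ≤ 1)
    (hc : ∀ p ∈ A, |c p| = a) (hcard : (θ : ℝ) * (A.card * a) = 1) :
    ‖∑ p ∈ A, c p • e θ schreierOne p‖ = 1 := by
  have hsum := mul_sum_abs_eq_one hc hcard
  refine le_antisymm ?_ ?_
  · exact (norm_sum_smul_e_le ha fun p hp => (hc p hp).le).trans (max_le ha1 hsum.le)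
  · calc 1 = θ * ∑ p ∈ A, |c p| := hsum.symm
      _ = θ * ∑ p ∈ A, |coord θ schreierOne p (∑ q ∈ A, c q • e θ schreierOne q)| :=
          congrArg _ (Finset.sum_congr rfl fun p hp => by rw [coord_sum_smul_e hp])
      _ ≤ ‖∑ p ∈ A, c p • e θ schreierOne p‖ := sum_abs_coord_le hA _

theorem norm_e_add_sum_smul_e_le_one_add (ha : 0 ≤ a) (ha1 : a ≤ 1) (hc : ∀ p ∈ A, |c p| = a)
    (hcard : (θ : ℝ) * (A.card * a) = 1) {i : ℕ+} (hi : i ∉ A) :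
    ‖e θ schreierOne i + ∑ p ∈ A, c p • e θ schreierOne p‖ ≤ 1 + (i : ℕ) * a := by
  have hsum := mul_sum_abs_eq_one hc hcard
  have hia : 0 ≤ ((i : ℕ) : ℝ) * a := by positivity
  refine (norm_e_add_sum_smul_e_le ha ha1 (fun p hp => (hc p hp).le) hi).trans
    (max_le (max_le ?_ ?_) ?_)
  · linarith
  · linarith
  · nlinarith [θ.2.1, θ.2.2]

theorem exists_flat_sum_eq_zero {L : Set ℕ+} (hL : L.Infinite) (i : ℕ+) {η : ℝ} (hη : 0 < η) :
    ∃ (D : Finset ℕ+) (c : ℕ+ → ℝ), (D : Set ℕ+) ⊆ L ∧ ∑ p ∈ D, c p = 0 ∧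
      θ * ∑ p ∈ D, |c p| = 1 ∧ ‖∑ p ∈ D, c p • e θ schreierOne p‖ = 1 ∧
      ‖e θ schreierOne i + ∑ p ∈ D, c p • e θ schreierOne p‖ ≤ 1 + η := by
  have hθ : (0 : ℝ) < θ := θ.2.1
  obtain ⟨N, hN⟩ := exists_nat_ge ((θ : ℝ)⁻¹ * max 1 ((i : ℕ) / η))
  obtain ⟨D, hDL, hDcard⟩ :=
    (hL.sdiff (Set.finite_Iic (max i (2 * N).succPNat))).exists_subset_card_eq (2 * N)
  have hDfar : ∀ p ∈ D, max i (2 * N).succPNat < p := fun p hp => not_le.1 (hDL hp).2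
  obtain ⟨s, hs, hs0⟩ := exists_abs_eq_one_sum_eq_zero (D := D) (hDcard ▸ even_two_mul N)
  set a := ((θ : ℝ) * D.card)⁻¹ with ha
  have hθN : max 1 ((i : ℕ) / η) ≤ θ * D.card := by
    rw [hDcard, ← div_le_iff₀' hθ, div_eq_inv_mul]
    exact hN.trans (by push_cast; linarith [N.cast_nonneg (α := ℝ)])
  have hpos : 0 < θ * (D.card : ℝ) := zero_lt_one.trans_le ((le_max_left _ _).trans hθN)
  have ha0 : 0 ≤ a := inv_nonneg.2 hpos.le
  have ha1 : a ≤ 1 := inv_le_one_of_one_le₀ ((le_max_left _ _).trans hθN)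
  have hia : (i : ℕ) * a ≤ η := by
    rw [ha, ← div_eq_mul_inv, div_le_comm₀ hpos hη]
    exact (le_max_right _ _).trans hθN
  have hcard : (θ : ℝ) * (D.card * a) = 1 := by rw [← mul_assoc, ha, mul_inv_cancel₀ hpos.ne']
  have hc : ∀ p ∈ D, |a * s p| = a := fun p _ => by rw [abs_mul, hs, mul_one, abs_of_nonneg ha0]
  refine ⟨D, fun p => a * s p, fun p hp => (hDL hp).1, ?_, mul_sum_abs_eq_one hc hcard,
    norm_sum_smul_e_eq_one (fun p hp => ?_) ha0 ha1 hc hcard,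
    (norm_e_add_sum_smul_e_le_one_add ha0 ha1 hc hcard fun hi => ?_).trans
      (add_le_add_right hia 1)⟩
  · rw [← Finset.mul_sum, hs0, mul_zero]
  · rw [hDcard]
    exact (Nat.le_succ _).trans
      (PNat.coe_le_coe _ _ |>.2 ((le_max_right i (2 * N).succPNat).trans (hDfar p hp).le))
  · exact (hDfar i hi).not_ge (le_max_left _ _)

theorem isLinftyAtInfinity_map_e {U : T θ schreierOne →L[ℝ] T θ schreierOne}
    (hU : ∀ x, ‖U x‖ = ‖x‖) (i : ℕ+) : IsLinftyAtInfinity (U (e θ schreierOne i)) := by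
  intro η hη m
  have hθ : (0 : ℝ) < θ := θ.2.1
  have hK : IsCompactOperator (restrict (Set.Iio m) ∘L U) := by
    rw [← Finset.coe_Iio]
    exact (isCompactOperator_restrict (Finset.Iio m)).comp_clm U
  obtain ⟨u₀, hu₀⟩ := exists_infinite_setOf_norm_sub_lt hK (mul_pos hθ hη)
  obtain ⟨D, c, hD, hc0, hc, hnorm, hadd⟩ := exists_flat_sum_eq_zero (θ := θ) hu₀ i hη
  refine ⟨U (∑ p ∈ D, c p • e θ schreierOne p), by rw [hU, hnorm],
    by rwa [← map_add, hU], ?_⟩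
  calc ‖restrict (Set.Iio m) (U (∑ p ∈ D, c p • e θ schreierOne p))‖
      = ‖∑ p ∈ D, c p • (restrict (Set.Iio m) ∘L U) (e θ schreierOne p)‖ := by
        simp only [map_sum, map_smul, ContinuousLinearMap.comp_apply]
    _ ≤ (∑ p ∈ D, |c p|) * (θ * η) := norm_sum_smul_le_of_sum_eq_zero hc0 fun p hp => (hD hp).le
    _ = η := by rw [← mul_assoc, mul_comm _ (θ : ℝ), hc, one_mul]

end FlatVectors

section SignedPermutation

variable {θ : Set.Ioc (0 : ℝ) (1 / 2)} {U : T θ schreierOne →L[ℝ] T θ schreierOne} {π : ℕ+ → ℕ+}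

theorem norm_e_add_smul_e_le_one {F : Set (Finset ℕ+)} {i j : ℕ+} (hij : i ≠ j) {c : ℝ}
    (hc : |c| ≤ 1) : ‖e θ F i + c • e θ F j‖ ≤ 1 := by
  have h := norm_sum_smul_e_le (θ := θ) (F := F) (A := {i, j}) (c := Function.update 1 j c)
    zero_le_one (by simpa [Finset.forall_mem_insert, hij] using hc)
  simp only [Finset.sum_pair hij, Function.update_of_ne hij, Function.update_self,
    Pi.one_apply, one_smul, abs_one] at h
  refine h.trans (max_le le_rfl ?_)
  nlinarith [θ.2.1, θ.2.2]

theorem eq_zero_of_abs_apply_e_eq_one {F : Set (Finset ℕ+)} {f : T θ F →L[ℝ] ℝ}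
    (hf : ∀ x, |f x| ≤ ‖x‖) {i j : ℕ+} (hi : |f (e θ F i)| = 1) (hij : i ≠ j) :
    f (e θ F j) = 0 := by
  have hle : ∀ c : ℝ, |c| ≤ 1 → |f (e θ F i) + c * f (e θ F j)| ≤ 1 := fun c hc => by
    simpa only [map_add, map_smul, smul_eq_mul] using
      (hf _).trans (norm_e_add_smul_e_le_one hij hc)
  have hadd := abs_le.1 (hle 1 (by simp))
  have hsub := abs_le.1 (hle (-1) (by simp))
  rcases eq_or_eq_neg_of_abs_eq hi with h | h <;> linarith

theorem mul_card_le_norm_sum_e (hU : ∀ x, ‖U x‖ = ‖x‖) (hinj : Function.Injective π)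
    (hπ : ∀ i, |coord θ schreierOne (π i) (U (e θ schreierOne i))| = 1)
    (hπ0 : ∀ i j, i ≠ j → coord θ schreierOne (π i) (U (e θ schreierOne j)) = 0)
    {C : Finset ℕ+} (hC : ∀ j ∈ C, C.card ≤ (π j : ℕ)) :
    θ * (C.card : ℝ) ≤ ‖∑ j ∈ C, e θ schreierOne j‖ := by
  have hcoord : ∀ j ∈ C,
      |coord θ schreierOne (π j) (U (∑ l ∈ C, e θ schreierOne l))| = 1 := fun j hj => by
    rw [map_sum, map_sum, Finset.sum_eq_single_of_mem j hj fun l _ hlj => hπ0 j l hlj.symm, hπ]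
  have hcard : (C.image π).card = C.card := Finset.card_image_of_injective C hinj
  calc θ * (C.card : ℝ)
      = θ * ∑ k ∈ C.image π, |coord θ schreierOne k (U (∑ l ∈ C, e θ schreierOne l))| := by
        rw [Finset.sum_image hinj.injOn, Finset.sum_congr rfl hcoord, Finset.sum_const,
          nsmul_eq_mul, mul_one]
    _ ≤ ‖U (∑ l ∈ C, e θ schreierOne l)‖ :=
        sum_abs_coord_le (Finset.forall_mem_image.2 fun j hj => hcard.trans_le (hC j hj)) _
    _ = ‖∑ l ∈ C, e θ schreierOne l‖ := hU _

/-- If `π i > i`, then `π i` unit vectors that include `e i` and are all sent beyond `π i` have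
images whose sum has norm at least `θ π i`, while the sum of the vectors themselves loses something
at `e i`. -/
theorem index_le_or_mul_index_le_one (hU : ∀ x, ‖U x‖ = ‖x‖) (hinj : Function.Injective π)
    (hπ : ∀ i, |coord θ schreierOne (π i) (U (e θ schreierOne i))| = 1)
    (hπ0 : ∀ i j, i ≠ j → coord θ schreierOne (π i) (U (e θ schreierOne j)) = 0) (i : ℕ+) :
    θ * ((π i : ℕ) : ℝ) ≤ 1 ∨ π i ≤ i := by
  refine or_iff_not_imp_right.2 fun hlt => ?_
  rw [not_le, ← PNat.coe_lt_coe] at hlt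
  have hfar : {j | π i ≤ π j}.Infinite := by
    have := ((Set.finite_Iio (π i)).preimage hinj.injOn).infinite_compl
    simpa only [Set.compl_def, Set.mem_preimage, Set.mem_Iio, not_lt] using this
  obtain ⟨m, hm⟩ := Nat.exists_eq_add_one.2 (π i).pos
  obtain ⟨B, hB, hBcard⟩ := (hfar.sdiff (Set.finite_singleton i)).exists_subset_card_eq m
  have hiB : i ∉ B := fun hi => (hB hi).2 rfl
  have hcard : (insert i B).card = (π i : ℕ) := by
    rw [Finset.card_insert_of_notMem hiB, hBcard, hm]
  have hlower := mul_card_le_norm_sum_e hU hinj hπ hπ0 (C := insert i B)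
    (Finset.forall_mem_insert .. |>.2 ⟨hcard.le, fun j hj =>
      hcard.trans_le (PNat.coe_le_coe _ _ |>.2 (hB hj).1)⟩)
  have hupper := norm_e_add_sum_smul_e_le (θ := θ) (c := 1) zero_le_one le_rfl
    (fun p _ => by simp) hiB
  simp only [Pi.one_apply, one_smul, abs_one, Finset.sum_const, nsmul_eq_mul, mul_one,
    hBcard] at hupper
  rw [hcard, Finset.sum_insert hiB] at hlower
  have hθ : (0 : ℝ) < θ := θ.2.1
  have him : ((i : ℕ) : ℝ) ≤ m := by exact_mod_cast Nat.lt_add_one_iff.1 (hm ▸ hlt)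
  have hmax := hlower.trans hupper
  rw [hm, Nat.cast_add_one, le_max_iff, le_max_iff] at hmax
  rw [hm, Nat.cast_add_one]
  rcases hmax with (h | h) | h
  · exact h
  · nlinarith
  · nlinarith

theorem exists_coord_map_e (hU : ∀ x, ‖U x‖ = ‖x‖) :
    ∃ π : ℕ+ → ℕ+, Function.Injective π ∧
      (∀ i, |coord θ schreierOne (π i) (U (e θ schreierOne i))| = 1) ∧
      ∀ i j, i ≠ j → coord θ schreierOne (π i) (U (e θ schreierOne j)) = 0 := by
  choose π hπ using fun i =>
    (isLinftyAtInfinity_map_e hU i).exists_abs_coord_eq_one ((hU _).trans (norm_e i))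
  have hπ0 : ∀ i j, i ≠ j → coord θ schreierOne (π i) (U (e θ schreierOne j)) = 0 :=
    fun i j => eq_zero_of_abs_apply_e_eq_one (f := coord θ schreierOne (π i) ∘L U)
      (fun x => (abs_coord_le _ _).trans_eq (hU x)) (hπ i)
  refine ⟨π, fun i j hij => by_contra fun hne => ?_, hπ, hπ0⟩
  have h := hπ j
  rw [← hij, hπ0 i j hne, abs_zero] at h
  exact zero_ne_one h

theorem exists_signed_permutation (hU : ∀ x, ‖U x‖ = ‖x‖) :
    ∃ (ε : ℕ+ → ℝ) (σ : Equiv.Perm ℕ+), (∀ i, ε i = 1 ∨ ε i = -1) ∧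
      (∀ i : ℕ+, ⌊(θ : ℝ)⁻¹⌋₊ < (i : ℕ) → σ i = i) ∧
      ∀ i, U (e θ schreierOne i) = ε i • e θ schreierOne (σ i) := by
  obtain ⟨π, hinj, hπ, hπ0⟩ := exists_coord_map_e hU
  set H : Set ℕ+ := {i | (i : ℕ) ≤ ⌊(θ : ℝ)⁻¹⌋₊}
  have hH : IsLowerSet H := fun _ _ hji hi => (PNat.coe_le_coe _ _ |>.2 hji).trans hi
  have hHfin : H.Finite := (Set.finite_Iic _).preimage PNat.coe_injective.injOn
  have hmove : ∀ i, π i ∈ H ∨ π i ≤ i := fun i =>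
    (index_le_or_mul_index_le_one hU hinj hπ hπ0 i).imp_left fun h =>
      Nat.le_floor <| by rwa [inv_eq_one_div, le_div_iff₀' θ.2.1]
  have hsurj := surjective_of_mem_or_le hH hHfin hinj hmove
  refine ⟨fun i => coord θ schreierOne (π i) (U (e θ schreierOne i)),
    Equiv.ofBijective π ⟨hinj, hsurj⟩, fun i => eq_or_eq_neg_of_abs_eq (hπ i),
    fun i hi => eq_self_of_mem_or_le hH hinj hmove hi.not_ge, fun i => ext_coord fun k => ?_⟩
  obtain ⟨j, rfl⟩ := hsurj k
  rw [map_smul, coord_e, smul_eq_mul]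
  split_ifs with hij
  · rw [hinj hij, mul_one]
  · rw [hπ0 j i fun h => hij (congrArg π h).symm, mul_zero]

end SignedPermutation

section Converse

variable {θ : Set.Ioc (0 : ℝ) (1 / 2)} {U : T θ schreierOne →L[ℝ] T θ schreierOne} {N : ℕ}
  {σ : Equiv.Perm ℕ+}

theorem tsNorm_le_of_perm (hN : (θ : ℝ) * N ≤ 1) (hσ : ∀ i : ℕ+, N < (i : ℕ) → σ i = i)
    {x y : ℕ+ →₀ ℝ} (h : ∀ i, |x (σ i)| ≤ |y i|) :
    tsNorm θ schreierOne x ≤ tsNorm θ schreierOne y := by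
  refine tsNorm_le_of_head θ.2.1.le (coe_le_one θ) hN (fun i _ => ?_) fun i hi => ?_
  · rw [← σ.apply_symm_apply i]
    exact (h _).trans (abs_le_tsNorm (coe_le_one θ) _ y _)
  · simpa only [hσ i hi] using h i

theorem tsNorm_eq_of_perm (hN : (θ : ℝ) * N ≤ 1) (hσ : ∀ i : ℕ+, N < (i : ℕ) → σ i = i)
    {x y : ℕ+ →₀ ℝ} (h : ∀ i, |x (σ i)| = |y i|) :
    tsNorm θ schreierOne x = tsNorm θ schreierOne y :=
  le_antisymm (tsNorm_le_of_perm hN hσ fun i => (h i).le) <|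
    tsNorm_le_of_perm (σ := σ.symm) hN (fun i hi => σ.symm_apply_eq.2 (hσ i hi).symm) fun i => by
      rw [← h, σ.apply_symm_apply]

/-- The linear map on `c₀₀` that sends the `j`-th unit vector to `ε j` times the `σ j`-th one. -/
def signedPerm (ε : ℕ+ → ℝ) (σ : Equiv.Perm ℕ+) : (ℕ+ →₀ ℝ) →ₗ[ℝ] (ℕ+ →₀ ℝ) :=
  Finsupp.lsum ℝ fun j => ε j • Finsupp.lsingle (σ j)

theorem signedPerm_apply (ε : ℕ+ → ℝ) (σ : Equiv.Perm ℕ+) (y : ℕ+ →₀ ℝ) (k : ℕ+) :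
    signedPerm ε σ y (σ k) = ε k * y k := by
  have h : Finsupp.lapply (σ k) ∘ₗ signedPerm ε σ = ε k • Finsupp.lapply k := by
    refine Finsupp.lhom_ext fun j a => ?_
    by_cases hjk : j = k
    · simp [signedPerm, hjk]
    · simp [signedPerm, Finsupp.single_eq_of_ne' hjk,
        Finsupp.single_eq_of_ne' (σ.injective.ne hjk)]
  exact LinearMap.congr_fun h y

theorem map_emb_eq_emb_signedPerm {ε : ℕ+ → ℝ}
    (hUe : ∀ i, U (e θ schreierOne i) = ε i • e θ schreierOne (σ i)) (y : ℕ+ →₀ ℝ) :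
    U (emb θ schreierOne y) = emb θ schreierOne (signedPerm ε σ y) := by
  have h : U.toLinearMap ∘ₗ emb θ schreierOne = emb θ schreierOne ∘ₗ signedPerm ε σ := by
    refine Finsupp.lhom_ext' fun j => LinearMap.ext_ring ?_
    simp only [signedPerm, LinearMap.comp_apply, Finsupp.lsum_single, LinearMap.smul_apply,
      Finsupp.lsingle_apply, map_smul, emb_single, ContinuousLinearMap.coe_coe, hUe]
  exact LinearMap.congr_fun h y

theorem norm_map_of_signed_permutation (hN : (θ : ℝ) * N ≤ 1)
    (hσ : ∀ i : ℕ+, N < (i : ℕ) → σ i = i) {ε : ℕ+ → ℝ} (hε : ∀ i, ε i = 1 ∨ ε i = -1)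
    (hUe : ∀ i, U (e θ schreierOne i) = ε i • e θ schreierOne (σ i)) (x : T θ schreierOne) :
    ‖U x‖ = ‖x‖ := by
  refine denseRange_emb.induction_on x (isClosed_eq (by fun_prop) (by fun_prop)) fun y => ?_
  rw [map_emb_eq_emb_signedPerm hUe, norm_emb, norm_emb]
  refine tsNorm_eq_of_perm hN hσ fun k => ?_
  rw [signedPerm_apply, abs_mul, abs_eq zero_le_one |>.2 (hε k), one_mul]

end Converse

theorem isometry_iff_exists_perm {θ : Set.Ioc (0 : ℝ) (1 / 2)}
    {U : T θ schreierOne →L[ℝ] T θ schreierOne} :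
    Isometry U ↔ ∃ (ε : ℕ+ → ℝ) (σ : Equiv.Perm ℕ+), (∀ i, ε i = 1 ∨ ε i = -1) ∧
      (∀ i : ℕ+, ⌊(θ : ℝ)⁻¹⌋₊ < (i : ℕ) → σ i = i) ∧
      ∀ i, U (e θ schreierOne i) = ε i • e θ schreierOne (σ i) := by
  refine ⟨fun hU => exists_signed_permutation (hU.norm_map_of_map_zero (map_zero U)), ?_⟩
  rintro ⟨ε, σ, hε, hσ, hUe⟩
  have hN : (θ : ℝ) * ⌊(θ : ℝ)⁻¹⌋₊ ≤ 1 :=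
    (le_div_iff₀' θ.2.1).1 ((Nat.floor_le (inv_nonneg.2 θ.2.1.le)).trans_eq (inv_eq_one_div _))
  exact AddMonoidHomClass.isometry_of_norm U (norm_map_of_signed_permutation hN hσ hε hUe)

end Tsirelson

end

theorem theoremA (θ : Set.Ioc (0 : ℝ) (1 / 2))
    (U : Tsirelson.T θ Tsirelson.schreierOne →ₗ[ℝ] Tsirelson.T θ Tsirelson.schreierOne) :
    Isometry U ↔
      Continuous U ∧
      ∃ (ε : ℕ+ → ℝ) (π : Equiv.Perm {i : ℕ+ // (i : ℕ) ≤ ⌊(θ : ℝ)⁻¹⌋₊}),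
        (∀ i, ε i = 1 ∨ ε i = -1) ∧
        (∀ i : {i : ℕ+ // (i : ℕ) ≤ ⌊(θ : ℝ)⁻¹⌋₊},
          U (Tsirelson.e θ Tsirelson.schreierOne i) =
            ε i • Tsirelson.e θ Tsirelson.schreierOne (π i)) ∧
        (∀ i : ℕ+, ⌊(θ : ℝ)⁻¹⌋₊ < (i : ℕ) →
          U (Tsirelson.e θ Tsirelson.schreierOne i) =
            ε i • Tsirelson.e θ Tsirelson.schreierOne i) := by
  constructor
  · intro hU
    obtain ⟨ε, σ, hε, hσ, hUe⟩ :=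
      Tsirelson.isometry_iff_exists_perm (U := ⟨U, hU.continuous⟩) |>.1 hU
    obtain ⟨π, hπ⟩ := (Equiv.Perm.subtypeEquivSubtypePerm
      fun i : ℕ+ => (i : ℕ) ≤ ⌊(θ : ℝ)⁻¹⌋₊).surjective ⟨σ, fun i hi => hσ i (not_le.1 hi)⟩
    obtain rfl : Equiv.Perm.ofSubtype π = σ := congrArg Subtype.val hπ
    refine ⟨hU.continuous, ε, π, hε, fun i => ?_, fun i hi => ?_⟩
    · exact Equiv.Perm.ofSubtype_apply_coe π i ▸ hUe i
    · exact (hUe i).trans (by rw [hσ i hi])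
  · rintro ⟨hcont, ε, π, hε, hsmall, hlarge⟩
    have hσ : ∀ i : ℕ+, ⌊(θ : ℝ)⁻¹⌋₊ < (i : ℕ) → Equiv.Perm.ofSubtype π i = i := fun i hi =>
      Equiv.Perm.ofSubtype_apply_of_not_mem π hi.not_ge
    refine (Tsirelson.isometry_iff_exists_perm (U := ⟨U, hcont⟩)).2
      ⟨ε, Equiv.Perm.ofSubtype π, hε, hσ, fun i => ?_⟩
    rcases le_or_gt (i : ℕ) ⌊(θ : ℝ)⁻¹⌋₊ with hi | hi
    · rw [Equiv.Perm.ofSubtype_apply_of_mem π hi]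
      exact hsmall ⟨i, hi⟩
    · rw [hσ i hi]
      exact hlarge i hi
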